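/- Let $(\Omega,\mathfrak F,P)$ be a probability space. For each $\Delta>0$ let $X_\Delta=(X_\Delta(t),t\in\mathbb R)$ be a (jointly measurable) stationary centred real Gaussian process on it with a spectral density $f_\Delta\ge 0$, i.e. $K_\Delta(t)=E X_\Delta(s+t)X_\Delta(s)=\int_{-\infty}^{\infty}e^{it\lambda}f_\Delta(\lambda)\,d\lambda$ for all $s,t\in\mathbb R$. Assume that every $f_\Delta$ is even and $f_\Delta\in L_1(\mathbb R)$, that $\sup_{\Delta>0}\sup_{\lambda\in\mathbb R}f_\Delta(\lambda)<\infty$, that $K_\Delta\in L_1(\mathbb R)$ for every $\Delta>0$, and that there is $c\in(0,\infty)$ with $$\lim_{\Delta\to\infty}\ \sup_{-a\le\lambda\le a}\Big|f_\Delta(\lambda)-\frac{c}{2\pi}\Big|=0\qquad\text{for all }a\in(0,\infty).$$ Let $U=(U(t),t\in\mathbb R)$ be a (jointly measurable) stationary centred real Gaussian process on the same space with an even spectral density $0\le g\in L_1(\mathbb R)$, such that for every $\Delta>0$ the processes $X_\Delta$ and $U$ are jointly Gaussian and orthogonal: $E X_\Delta(s)U(t)=0$ for all $s,t\in\mathbb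 R$. Let $H\in L_2(\mathbb R)$ be real-valued and let $H^*(\lambda)=\int_{-\infty}^{\infty}e^{-i\lambda x}H(x)\,dx$ be its Fourier–Plancherel transform. For $T,\Delta>0$ and $t,\tau\in\mathbb R$ put $$Y_\Delta(t)=\int_{-\infty}^{\infty}H(s)X_\Delta(t-s)\,ds+U(t),\qquad H_{T,\Delta}(\tau)=\frac1{cT}\int_0^T Y_\Delta(t+\tau)X_\Delta(t)\,dt,$$ $$Z_{T,\Delta}(\tau)=\sqrt T\,\big[H_{T,\Delta}(\tau)-E H_{T,\Delta}(\tau)\big],$$ where the first integral is the limit in mean square of the integrals over $[a,b]$ as $a\to-\infty$, $b\to\infty$, and the second is a mean-square Riemann integral. Then both integrals exist for all $T,\Delta>0$ and $t,\tau\in\mathbb R$, and for all $\tau_1,\tau_2\in\mathbb R$, as $T\to\infty$ and $\Delta\to\infty$ simultaneously and in an arbitrary way, $$\lim_{(T,\Delta)\to\infty}E\,Z_{T,\Delta}(\tau_1)Z_{T,\Delta}(\tau_2)=C_\infty(\tau_1,\tau_2),$$ where $$C_\infty(\tau_1,\tau_2)=\frac1{2\pi}\int_{-\infty}^{\infty}\Big[e^{i(\tau_1-\tau_2)\lambda}\Big(|H^*(\lambda)|^2+\frac{2\pi}{c}g(\lambda)\Big)+e^{i(\tau_1+\tau_2)\lambda}\big(H^*(\lambda)\big)^2\Big]d\lambda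 .$$ -/

import Mathlib

open MeasureTheory ProbabilityTheory Filter Set
open scoped Topology FourierTransform ENNReal

noncomputable section

namespace Correlogram

variable {Ω : Type*} [MeasurableSpace Ω]

/-! ### Mean-square limits and integrals -/

/-- `L` is the limit in mean square of the random variables `S i` along the filter `l`. -/
def IsMsLimit {ι : Type*} (P : Measure Ω) (l : Filter ι) (S : ι → Ω → ℝ) (L : Ω → ℝ) : Prop :=
  MemLp L 2 P ∧ Tendsto (fun i => eLpNorm (S i - L) 2 P) l (𝓝 0)

/-- The limit in mean square exists. -/
def MsConverges {ι : Type*} (P : Measure Ω) (l : Filter ι) (S : ι → Ω → ℝ) : Prop :=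
  ∃ L : Ω → ℝ, IsMsLimit P l S L

open Classical in
/-- A version of the limit in mean square (it is unique up to `P`-null sets);
by convention `0` if there is no limit. -/
def msLimit {ι : Type*} (P : Measure Ω) (l : Filter ι) (S : ι → Ω → ℝ) : Ω → ℝ :=
  if h : MsConverges P l S then h.choose else 0

/-- A tagged partition `a = pt 0 ≤ pt 1 ≤ ⋯ ≤ pt n = b`, `tag i ∈ [pt i, pt (i + 1)]`. -/
structure TaggedPartition (a b : ℝ) where
  n : ℕ
  pt : ℕ → ℝ
  tag : ℕ → ℝ
  pt_zero : pt 0 = a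
  pt_last : pt n = b
  pt_le : ∀ i < n, pt i ≤ pt (i + 1)
  tag_mem : ∀ i < n, tag i ∈ Icc (pt i) (pt (i + 1))

/-- The filter "mesh of the tagged partition tends to `0`". -/
def meshFilter (a b : ℝ) : Filter (TaggedPartition a b) :=
  ⨅ δ : {δ : ℝ // 0 < δ}, 𝓟 {π | ∀ i < π.n, π.pt (i + 1) - π.pt i < δ}

/-- Riemann sums of a random process. -/
def riemannSum (ξ : ℝ → Ω → ℝ) {a b : ℝ} (π : TaggedPartition a b) : Ω → ℝ :=
  fun ω => ∑ i ∈ Finset.range π.n, (π.pt (i + 1) - π.pt i) * ξ (π.tag i) ω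

/-- The mean-square Riemann integral `∫_a^b ξ(t) dt`. -/
def msRiemannIntegral (P : Measure Ω) (ξ : ℝ → Ω → ℝ) (a b : ℝ) : Ω → ℝ :=
  msLimit P (meshFilter a b) (riemannSum ξ)

/-! ### Stationary Gaussian processes with a spectral density -/

/-- The correlation function `K(t) = E X(t) X(0)` of a centred stationary process. -/
def corrFun (P : Measure Ω) (X : ℝ → Ω → ℝ) (t : ℝ) : ℝ :=
  ∫ ω, X t ω * X 0 ω ∂P

/-- `X` is a measurable stationary centred real Gaussian process with even integrable spectral
density `f`: `E X(s + t) X(s) = ∫ e^{i t x} f(x) dx`. (A centred Gaussian process whose covariance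
depends only on the time lag is stationary.) -/
structure IsStationaryGaussian (P : Measure Ω) (X : ℝ → Ω → ℝ) (f : ℝ → ℝ) : Prop where
  measurable : Measurable (Function.uncurry X)
  gaussian : IsGaussianProcess X P
  centered : ∀ t, ∫ ω, X t ω ∂P = 0
  density_nonneg : ∀ x, 0 ≤ f x
  density_even : ∀ x, f (-x) = f x
  density_integrable : Integrable f
  covariance : ∀ s t : ℝ, ((∫ ω, X (s + t) ω * X s ω ∂P : ℝ) : ℂ) =
    ∫ x : ℝ, Complex.exp (Complex.I * t * x) * f x

/-! ### The system, the correlogram and its normalized deviation -/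

/-- The truncated response `∫_a^b H(s) X(t - s) ds`, with `p = (a, b)`. -/
def truncatedResponse (H : ℝ → ℝ) (X : ℝ → Ω → ℝ) (t : ℝ) (p : ℝ × ℝ) : Ω → ℝ :=
  fun ω => ∫ s in p.1..p.2, H s * X (t - s) ω

/-- The response `Y(t) = ∫_{-∞}^∞ H(s) X(t - s) ds + U(t)`, the integral being the limit in mean
square of the integrals over `[a, b]` as `a → -∞`, `b → ∞`. -/
def response (P : Measure Ω) (H : ℝ → ℝ) (X U : ℝ → Ω → ℝ) (t : ℝ) : Ω → ℝ :=
  fun ω => msLimit P (atBot ×ˢ atTop) (truncatedResponse H X t) ω + U t ω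

/-- The correlogram estimator `(1 / (c T)) ∫_0^T Y(t + τ) X(t) dt`, where `Y` is the response. -/
def estimator (P : Measure Ω) (H : ℝ → ℝ) (X U : ℝ → Ω → ℝ) (c T τ : ℝ) : Ω → ℝ :=
  fun ω => 1 / (c * T) *
    msRiemannIntegral P (fun t ω => response P H X U (t + τ) ω * X t ω) 0 T ω

/-- `Z(τ) = √T (Ĥ(τ) - E Ĥ(τ))`, where `Ĥ` is the correlogram estimator. -/
def deviation (P : Measure Ω) (H : ℝ → ℝ) (X U : ℝ → Ω → ℝ) (c T τ : ℝ) : Ω → ℝ :=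
  fun ω => √T * (estimator P H X U c T τ ω - ∫ ω', estimator P H X U c T τ ω' ∂P)

/-- The Fourier–Plancherel transform `H*(x) = ∫ e^{-i x s} H(s) ds` of `H ∈ L²(ℝ)`.
Mathlib's `𝓕` has the kernel `e^{-2π i x s}`, hence the rescaling. -/
def plancherel (H : ℝ → ℝ) (hH : MemLp H 2 volume) (x : ℝ) : ℂ :=
  (𝓕 (MemLp.toLp (fun s => (H s : ℂ)) hH.ofReal) : Lp ℂ 2 (volume : Measure ℝ))
    (x / (2 * Real.pi))

/-- The limit correlation function. -/
def limitCorr (H : ℝ → ℝ) (hH : MemLp H 2 volume) (g : ℝ → ℝ) (c τ₁ τ₂ : ℝ) : ℂ :=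
  1 / (2 * Real.pi) * ∫ x : ℝ,
    (Complex.exp (Complex.I * (τ₁ - τ₂) * x) *
        ((‖plancherel H hH x‖ ^ 2 : ℝ) + 2 * Real.pi / c * g x) +
      Complex.exp (Complex.I * (τ₁ + τ₂) * x) * plancherel H hH x ^ 2)

end Correlogram

end

/-! The input and the noise are treated as curves in the Hilbert space `L²(P)`, and the proof is a
covariance computation there. Since `f_Δ ≤ M`, Plancherel gives `‖∫ h(s) X(t - s) ds‖² = ∫ |h*|² f_Δ
≤ 2π M ‖h‖²` for `h ∈ L¹ ∩ L²`. The truncated responses are therefore Cauchy, and the mean-square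
limit exists for every `H ∈ L²`. The output has spectral density `|H*|² f_Δ + g` and cross-spectrum
`H* f_Δ` with the input.

Input, noise and output lie in one closed space of centred Gaussian variables, because Gaussian laws
survive `L²` limits. Wick's formula then gives the covariance of the products `Y(t + τ) X(t)`. It
makes `t ↦ Y(t + τ) X(t)` continuous in `L²(P)`, so the Riemann integral exists. Centring removes
one of the three pairings, leaving `K_Y K_X` and the product of two cross-correlations, averaged
over `[0, T]²`. Written as Fourier integrals, these averages become bilinear forms in the spectra
with the Fejér kernel at scale `1/T` (`integral_integral_chr_mul_chr`, `covariance_deviation_eq`).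

The two forms need different limit arguments, both in `tendsto_spectral_covariance`. In the first,
the kernel acts on `f_Δ`, which is bounded and locally uniformly close to `c/2π`; its Fejér mean
tends boundedly to `c`, while `|H*|² M + g` is an integrable majorant
(`tendsto_integral_mul_fejerMean`). In the second, the kernel acts on `H* f_Δ`, whose factor `H*` is
only known to be in `L²`. There the kernel is moved to the lag of the correlation `∫ a(y) b(y - w/T)
dy`, and continuity of translations in `L²` gives the limit
(`tendsto_integral_fejer_mul_correlation`). Neither argument relates the rates of `T` and `Δ`, so
the joint limit is unrestricted. -/

noncomputable section

namespace Correlogram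

/-! ### The Fourier–Plancherel transform -/

/-- On `L¹ ∩ L²` the Fourier–Plancherel transform is given by the Fourier integral. -/
theorem fourier_toLp_ae_eq {h : ℝ → ℂ} (h1 : Integrable h) (h2 : MemLp h 2) :
    (𝓕 (h2.toLp h) : Lp ℂ 2 (volume : Measure ℝ)) =ᵐ[volume] 𝓕 h := by
  have hc : Continuous (𝓕 h) :=
    VectorFourier.fourierIntegral_continuous Real.continuous_fourierChar
      continuous_inner h1
  -- Both sides are tested against smooth compactly supported functions. Such a function is
  -- Schwartz, so the Fourier transform can be shifted onto it: for the `L²` transform through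
  -- tempered distributions, for the integral through Fubini.
  refine ae_eq_of_integral_contDiff_smul_eq
    ((Lp.memLp _).locallyIntegrable (by norm_num)) hc.locallyIntegrable ?_
  intro φ hφ hφc
  have hφ' : ContDiff ℝ ((⊤ : ℕ∞) : WithTop ℕ∞) (fun x => (φ x : ℂ)) :=
    Complex.ofRealCLM.contDiff.comp hφ
  have hφc' : HasCompactSupport (fun x => (φ x : ℂ)) := hφc.comp_left (g := fun r : ℝ => (r : ℂ))
    (by simp)
  set ψ : SchwartzMap ℝ ℂ := hφc'.toSchwartzMap hφ' with hψ
  have key := congrArg (fun D => D ψ) (Lp.fourier_toTemperedDistribution_eq (h2.toLp h))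
  simp only [TemperedDistribution.fourier_apply, Lp.toTemperedDistribution_apply] at key
  have e1 : ∀ u : ℝ → ℂ, ∫ x, φ x • u x = ∫ x, ψ x • u x := by
    intro u
    refine integral_congr_ae (Eventually.of_forall fun x => ?_)
    simp [hψ]
  rw [e1, e1, ← key]
  have e2 : ∫ x, (𝓕 ψ) x • (h2.toLp h) x = ∫ x, (𝓕 ψ) x • h x := by
    refine integral_congr_ae ?_
    filter_upwards [h2.coeFn_toLp] with x hx
    rw [hx]
  rw [e2]
  have e3 := VectorFourier.integral_fourierIntegral_smul_eq_flip (L := innerₗ ℝ)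
      (μ := volume) (ν := volume) Real.continuous_fourierChar
      continuous_inner ψ.integrable h1
  simp only [flip_innerₗ] at e3
  exact e3

/-- The Fourier integral `∫ e^{-i x s} h(s) ds`. -/
def angularFourier (h : ℝ → ℝ) (x : ℝ) : ℂ := ∫ s : ℝ, Complex.exp (-(Complex.I * x * s)) * h s

theorem angularFourier_eq_fourier (h : ℝ → ℝ) (x : ℝ) :
    angularFourier h x = 𝓕 (fun s => (h s : ℂ)) (x / (2 * Real.pi)) := by
  rw [Real.fourier_eq', angularFourier]
  refine integral_congr_ae (Eventually.of_forall fun s => ?_)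
  simp only [smul_eq_mul]
  congr 2
  simp only [RCLike.inner_apply, conj_trivial]
  push_cast
  have : (Real.pi : ℂ) ≠ 0 := by exact_mod_cast Real.pi_ne_zero
  field_simp

theorem two_pi_pos : 0 < 2 * Real.pi := by positivity

theorem map_div_two_pi :
    Measure.map (fun x : ℝ => x / (2 * Real.pi)) volume
      = ENNReal.ofReal (2 * Real.pi) • (volume : Measure ℝ) := by
  have h := Real.map_volume_mul_right (a := (2 * Real.pi)⁻¹) (inv_ne_zero two_pi_pos.ne')
  simp only [inv_inv, abs_of_pos two_pi_pos] at h
  simpa only [div_eq_mul_inv] using h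

/-- `plancherel` evaluates a representative of an `Lp` class at `x / (2π)`; almost-everywhere
identities survive this rescaling only because null sets pull back to null sets. -/
theorem quasiMeasurePreserving_div_two_pi :
    Measure.QuasiMeasurePreserving (fun x : ℝ => x / (2 * Real.pi)) := by
  refine ⟨by fun_prop, ?_⟩
  rw [map_div_two_pi]
  exact Measure.smul_absolutelyContinuous

theorem eLpNorm_comp_div_two_pi {u : ℝ → ℂ} (hu : AEStronglyMeasurable u volume) :
    eLpNorm (fun x => u (x / (2 * Real.pi))) 2 volume
      = ENNReal.ofReal (2 * Real.pi) ^ (1 / 2 : ℝ) * eLpNorm u 2 volume := by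
  have h0 : ENNReal.ofReal (2 * Real.pi) ≠ 0 := by simp [Real.pi_pos]
  have hm : AEStronglyMeasurable u (Measure.map (fun x : ℝ => x / (2 * Real.pi)) volume) := by
    rw [map_div_two_pi]; exact hu.smul_measure _
  have := eLpNorm_map_measure (p := 2) hm (by fun_prop)
  rw [map_div_two_pi, eLpNorm_smul_measure_of_ne_zero h0] at this
  rw [Function.comp_def] at this
  rw [← this]
  simp

theorem memLp_plancherel (H : ℝ → ℝ) (hH : MemLp H 2 volume) :
    MemLp (plancherel H hH) 2 volume := by
  have hm := Lp.memLp (𝓕 (MemLp.toLp (fun s => (H s : ℂ)) hH.ofReal) : Lp ℂ 2 (volume : Measure ℝ))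
  refine ⟨hm.1.comp_quasiMeasurePreserving quasiMeasurePreserving_div_two_pi, ?_⟩
  unfold plancherel
  rw [eLpNorm_comp_div_two_pi hm.1]
  exact ENNReal.mul_lt_top (ENNReal.rpow_lt_top_of_nonneg (by norm_num) ENNReal.ofReal_ne_top) hm.2

/-- The unitary normalization of `𝓕` makes it an isometry; the factor `√(2π)` is the Jacobian of the
rescaling. The form with a difference is the one needed to pass to limits in `H`. -/
theorem eLpNorm_plancherel_sub {H K : ℝ → ℝ} (hH : MemLp H 2 volume) (hK : MemLp K 2 volume) :
    eLpNorm (plancherel H hH - plancherel K hK) 2 volume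
      = ENNReal.ofReal (2 * Real.pi) ^ (1 / 2 : ℝ) * eLpNorm (H - K) 2 volume := by
  set A := MemLp.toLp (fun s => (H s : ℂ)) hH.ofReal
  set B := MemLp.toLp (fun s => (K s : ℂ)) hK.ofReal
  have e : plancherel H hH - plancherel K hK
      = fun x => ((𝓕 A : Lp ℂ 2 (volume : Measure ℝ)) - (𝓕 B : Lp ℂ 2 (volume : Measure ℝ)) :
        ℝ → ℂ) (x / (2 * Real.pi)) := rfl
  rw [e, eLpNorm_comp_div_two_pi ((Lp.aestronglyMeasurable _).sub (Lp.aestronglyMeasurable _))]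
  congr 1
  rw [← eLpNorm_congr_ae (Lp.coeFn_sub _ _)]
  have hsub : (𝓕 A - 𝓕 B : Lp ℂ 2 (volume : Measure ℝ)) = 𝓕 (A - B) :=
    ((Lp.fourierTransformₗᵢ ℝ ℂ).map_sub A B).symm
  have hn := Lp.norm_fourier_eq (A - B)
  rw [← hsub, Lp.norm_def, Lp.norm_def,
    ENNReal.toReal_eq_toReal_iff' (Lp.eLpNorm_ne_top _) (Lp.eLpNorm_ne_top _)] at hn
  rw [hn, eLpNorm_congr_ae (Lp.coeFn_sub _ _),
    eLpNorm_congr_ae (hH.ofReal.coeFn_toLp.sub hK.ofReal.coeFn_toLp)]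
  refine eLpNorm_congr_norm_ae (Eventually.of_forall fun x => ?_)
  simp only [Pi.sub_apply]
  rw [← Complex.norm_real]
  push_cast
  rfl

theorem plancherel_ae_eq_angularFourier {h : ℝ → ℝ} (h1 : Integrable h) (h2 : MemLp h 2 volume) :
    plancherel h h2 =ᵐ[volume] angularFourier h := by
  have := quasiMeasurePreserving_div_two_pi.ae (fourier_toLp_ae_eq h1.ofReal h2.ofReal)
  filter_upwards [this] with x hx
  rw [angularFourier_eq_fourier]
  exact hx

theorem integral_norm_sq_eq_eLpNorm {α E : Type*} [MeasurableSpace α] {μ : Measure α}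
    [NormedAddCommGroup E] {u : α → E} (hu : MemLp u 2 μ) :
    ∫ x, ‖u x‖ ^ 2 ∂μ = (eLpNorm u 2 μ).toReal ^ 2 := by
  have := hu.eLpNorm_eq_integral_rpow_norm (by norm_num) (by norm_num)
  rw [this, ENNReal.toReal_ofReal (by positivity)]
  have h0 : 0 ≤ ∫ x, ‖u x‖ ^ 2 ∂μ := integral_nonneg fun x => by positivity
  simp only [ENNReal.toReal_ofNat, Real.rpow_ofNat]
  rw [← Real.rpow_natCast, ← Real.rpow_mul h0]
  norm_num

theorem memLp_angularFourier {h : ℝ → ℝ} (h1 : Integrable h) (h2 : MemLp h 2 volume) :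
    MemLp (angularFourier h) 2 volume :=
  (memLp_congr_ae (plancherel_ae_eq_angularFourier h1 h2)).1 (memLp_plancherel h h2)

/-- Plancherel's identity. -/
theorem integral_norm_sq_angularFourier {h : ℝ → ℝ} (h1 : Integrable h) (h2 : MemLp h 2 volume) :
    ∫ x, ‖angularFourier h x‖ ^ 2 = 2 * Real.pi * ∫ s, h s ^ 2 := by
  -- The isometry is stated for differences, so a norm is obtained by comparison with the transform
  -- of `0`.
  have e0 : plancherel (0 : ℝ → ℝ) MemLp.zero =ᵐ[volume] 0 := by
    filter_upwards [plancherel_ae_eq_angularFourier (h := 0) (integrable_zero _ _ _) MemLp.zero]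
      with x hx
    rw [hx]; simp [angularFourier]
  have e1 := eLpNorm_plancherel_sub h2 (MemLp.zero (μ := volume) (p := 2))
  rw [eLpNorm_congr_ae ((plancherel_ae_eq_angularFourier h1 h2).sub e0), sub_zero, sub_zero] at e1
  rw [integral_norm_sq_eq_eLpNorm (memLp_angularFourier h1 h2), e1, ENNReal.toReal_mul, mul_pow,
    ← integral_norm_sq_eq_eLpNorm h2, ← ENNReal.toReal_rpow,
    ENNReal.toReal_ofReal two_pi_pos.le, ← Real.sqrt_eq_rpow, Real.sq_sqrt two_pi_pos.le]
  simp

theorem continuous_angularFourier {h : ℝ → ℝ} (h1 : Integrable h) :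
    Continuous (angularFourier h) := by
  refine continuous_of_dominated (bound := fun s => |h s|) (fun x => ?_) (fun x => ?_) h1.abs ?_
  · exact (Continuous.aestronglyMeasurable (by fun_prop)).mul
      (Complex.continuous_ofReal.comp_aestronglyMeasurable h1.1)
  · refine Eventually.of_forall fun s => ?_
    rw [norm_mul, show -(Complex.I * x * s) = ((-(x * s) : ℝ) : ℂ) * Complex.I by push_cast; ring,
      Complex.norm_exp_ofReal_mul_I]
    simp
  · exact Eventually.of_forall fun s => by fun_prop

theorem norm_angularFourier_le (h : ℝ → ℝ) (x : ℝ) : ‖angularFourier h x‖ ≤ ∫ s, |h s| := by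
  refine (norm_integral_le_integral_norm _).trans (le_of_eq ?_)
  congr 1
  ext s
  rw [norm_mul, show -(Complex.I * x * s) = ((-(x * s) : ℝ) : ℂ) * Complex.I by push_cast; ring,
    Complex.norm_exp_ofReal_mul_I]
  simp

/-! ### Convergence in `L²` -/

/-- The bilinear integral is an `L²` inner product once one factor is conjugated, and inner products
are jointly continuous. -/
theorem tendsto_integral_mul_of_tendsto_eLpNorm {α ι : Type*} [MeasurableSpace α] {μ : Measure α}
    {l : Filter ι} {a b : ι → α → ℂ} {a₀ b₀ : α → ℂ}
    (ha : ∀ i, MemLp (a i) 2 μ) (hb : ∀ i, MemLp (b i) 2 μ)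
    (ha₀ : MemLp a₀ 2 μ) (hb₀ : MemLp b₀ 2 μ)
    (hat : Tendsto (fun i => eLpNorm (a i - a₀) 2 μ) l (𝓝 0))
    (hbt : Tendsto (fun i => eLpNorm (b i - b₀) 2 μ) l (𝓝 0)) :
    Tendsto (fun i => ∫ x, a i x * b i x ∂μ) l (𝓝 (∫ x, a₀ x * b₀ x ∂μ)) := by
  have inner_eq : ∀ {u v : α → ℂ} (hu : MemLp u 2 μ) (hv : MemLp v 2 μ),
      inner ℂ (hu.star.toLp _) (hv.toLp _) = ∫ x, v x * u x ∂μ := by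
    intro u v hu hv
    rw [L2.inner_def]
    refine integral_congr_ae ?_
    filter_upwards [hu.star.coeFn_toLp, hv.coeFn_toLp] with x h1 h2
    rw [h1, h2]
    simp [mul_comm]
  have hat' : Tendsto (fun i => (ha i).toLp (a i)) l (𝓝 (ha₀.toLp a₀)) :=
    (Lp.tendsto_Lp_iff_tendsto_eLpNorm'' _ _ _ _).2 hat
  have hbt' : Tendsto (fun i => (hb i).star.toLp _) l (𝓝 (hb₀.star.toLp _)) := by
    refine (Lp.tendsto_Lp_iff_tendsto_eLpNorm'' _ _ _ _).2 (hbt.congr fun i => ?_)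
    refine eLpNorm_congr_norm_ae (Eventually.of_forall fun x => ?_)
    simp only [Pi.sub_apply, Pi.star_apply]
    rw [← star_sub, norm_star]
  have := hbt'.inner (𝕜 := ℂ) hat'
  rw [inner_eq hb₀ ha₀] at this
  exact this.congr fun i => inner_eq (hb i) (ha i)

theorem integrable_mul_of_memLp_two {α : Type*} [MeasurableSpace α] {μ : Measure α}
    {a b : α → ℂ} (ha : MemLp a 2 μ) (hb : MemLp b 2 μ) :
    Integrable (fun x => a x * b x) μ :=
  ha.integrable_mul hb

/-- Translations act continuously on `L²`. -/
theorem tendsto_eLpNorm_translate_sub {b : ℝ → ℂ} (hb : MemLp b 2 volume) :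
    Tendsto (fun v : ℝ => eLpNorm (fun x => b (x - v) - b x) 2 volume) (𝓝 0) (𝓝 0) := by
  have hg : ∀ v : ℝ, MeasurePreserving (fun x : ℝ => x - v) volume volume := fun v =>
    measurePreserving_sub_right volume v
  let G : ℝ → C(ℝ, ℝ) := fun v => ⟨fun x => x - v, by fun_prop⟩
  have hG : Continuous G := by
    refine ContinuousMap.continuous_of_continuous_uncurry _ ?_
    simp only [G, Function.uncurry_def, ContinuousMap.coe_mk]
    fun_prop
  have := Filter.Tendsto.compMeasurePreservingLp (μ := volume) (ν := volume) (p := 2)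
    (tendsto_const_nhds (x := hb.toLp b) (f := 𝓝 (0 : ℝ))) (hG.tendsto 0)
    (fun v => hg v) (hg 0) (by norm_num)
  rw [Lp.tendsto_Lp_iff_tendsto_eLpNorm'] at this
  refine this.congr fun v => eLpNorm_congr_ae ?_
  have h1 : ∀ v : ℝ, (Lp.compMeasurePreserving (G v) (hg v) (hb.toLp b) : ℝ → ℂ)
      =ᵐ[volume] fun x => b (x - v) := fun v => by
    filter_upwards [Lp.coeFn_compMeasurePreserving (hb.toLp b) (hg v),
      (hg v).quasiMeasurePreserving.ae hb.coeFn_toLp] with x hx hx2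
    rw [← hx2]; exact hx
  filter_upwards [h1 v, h1 0] with x hx h0
  rw [Pi.sub_apply, hx, h0, sub_zero]

variable {Ω : Type*} [MeasurableSpace Ω]

/-! ### Gaussian Hilbert spaces -/

theorem real_inner_eq_integral {P : Measure Ω} (ξ η : Lp ℝ 2 P) :
    inner ℝ ξ η = ∫ ω, ξ ω * η ω ∂P := by
  rw [L2.inner_def]
  refine integral_congr_ae (Eventually.of_forall fun ω => ?_)
  simp [mul_comm]

theorem real_inner_toLp {P : Measure Ω} {u v : Ω → ℝ} (hu : MemLp u 2 P) (hv : MemLp v 2 P) :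
    inner ℝ (hu.toLp u) (hv.toLp v) = ∫ ω, u ω * v ω ∂P := by
  rw [real_inner_eq_integral]
  refine integral_congr_ae ?_
  filter_upwards [hu.coeFn_toLp, hv.coeFn_toLp] with ω h1 h2
  rw [h1, h2]

theorem norm_sq_eq_integral {P : Measure Ω} (ξ : Lp ℝ 2 P) : ‖ξ‖ ^ 2 = ∫ ω, ξ ω ^ 2 ∂P := by
  rw [← real_inner_self_eq_norm_sq, real_inner_eq_integral]
  simp_rw [sq]

theorem map_eq_gaussianReal_of_mem_span {P : Measure Ω} {T : Type*} {Z : T → Ω → ℝ}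
    (hZ : IsGaussianProcess Z P) (h0 : ∀ t, ∫ ω, Z t ω ∂P = 0) {z : T → Lp ℝ 2 P}
    (hz : ∀ t, z t =ᵐ[P] Z t) {ξ : Lp ℝ 2 P} (hξ : ξ ∈ Submodule.span ℝ (Set.range z)) :
    P.map ξ = gaussianReal 0 (‖ξ‖₊ ^ 2) := by
  have := hZ.isProbabilityMeasure
  obtain ⟨c, rfl⟩ := (Finsupp.mem_span_range_iff_exists_finsupp).1 hξ
  have hsum : ((c.sum fun t a => a • z t : Lp ℝ 2 P) : Ω → ℝ)
      =ᵐ[P] ∑ t ∈ c.support, (c t) • Z t := by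
    unfold Finsupp.sum
    refine (Lp.coeFn_finsetSum c.support (fun t => c t • z t)).trans ?_
    refine eventuallyEq_sum fun t _ => ?_
    filter_upwards [Lp.coeFn_smul (c t) (z t), hz t] with ω h1 h2
    rw [h1, Pi.smul_apply, h2, Pi.smul_apply]
  have hg : HasGaussianLaw (∑ t ∈ c.support, (c t) • Z t) P :=
    (hZ.smul c).hasGaussianLaw_sum
  set ξ : Lp ℝ 2 P := c.sum fun t a => a • z t
  have hg' : HasGaussianLaw (ξ : Ω → ℝ) P := hg.congr hsum.symm
  have hmean : ∫ ω, ξ ω ∂P = 0 := by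
    rw [integral_congr_ae hsum]
    simp only [Finset.sum_apply, Pi.smul_apply, smul_eq_mul]
    rw [integral_finsetSum]
    · simp [integral_const_mul, h0]
    · intro t _
      exact (hZ.hasGaussianLaw_eval t).integrable.const_mul _
  rw [hg'.map_eq_gaussianReal, hmean]
  congr 1
  apply NNReal.eq
  rw [Real.coe_toNNReal _ (variance_nonneg _ _),
    variance_of_integral_eq_zero hg'.aemeasurable hmean]
  simp [norm_sq_eq_integral]

theorem norm_exp_mul_I_sub_le (x y : ℝ) :
    ‖Complex.exp (x * Complex.I) - Complex.exp (y * Complex.I)‖ ≤ |x - y| := by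
  have h : Complex.exp (x * Complex.I) - Complex.exp (y * Complex.I)
      = Complex.exp (y * Complex.I) * (Complex.exp (Complex.I * ((x - y : ℝ) : ℂ)) - 1) := by
    rw [mul_sub, ← Complex.exp_add, mul_one]
    congr 2
    push_cast; ring
  rw [h, norm_mul, Complex.norm_exp_ofReal_mul_I, one_mul]
  simpa using Real.norm_exp_I_mul_ofReal_sub_one_le (x := x - y)

/-- `x ↦ e^{i r x}` is `|r|`-Lipschitz and the `L¹` norm is at most the `L²` norm under a
probability measure, so the map is even Lipschitz. -/
theorem continuous_charFun_map {P : Measure Ω} [IsProbabilityMeasure P] (r : ℝ) :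
    Continuous fun ξ : Lp ℝ 2 P => charFun (P.map ξ) r := by
  have e : ∀ ξ : Lp ℝ 2 P, charFun (P.map ξ) r
      = ∫ ω, Complex.exp ((r * ξ ω : ℝ) * Complex.I) ∂P := by
    intro ξ
    rw [charFun_apply_real, integral_map (Lp.aestronglyMeasurable ξ).aemeasurable
      (by fun_prop)]
    simp
  have hint : ∀ ξ : Lp ℝ 2 P,
      Integrable (fun ω => Complex.exp ((r * ξ ω : ℝ) * Complex.I)) P := by
    intro ξ
    refine Integrable.of_bound (C := 1) ?_ (Eventually.of_forall fun ω => ?_)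
    · exact (show Continuous fun x : ℝ => Complex.exp ((r * x : ℝ) * Complex.I) by
        fun_prop).comp_aestronglyMeasurable (Lp.aestronglyMeasurable ξ)
    · rw [Complex.norm_exp_ofReal_mul_I]
  refine (LipschitzWith.of_dist_le_mul (K := ‖r‖₊) fun ξ η => ?_).continuous
  rw [e, e, dist_eq_norm, ← integral_sub (hint ξ) (hint η)]
  have hd : Integrable (fun ω => ξ ω - η ω) P :=
    ((Lp.memLp ξ).sub (Lp.memLp η)).integrable (by norm_num)
  calc ‖∫ ω, (Complex.exp ((r * ξ ω : ℝ) * Complex.I) - Complex.exp ((r * η ω : ℝ) * Complex.I)) ∂P‖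
      ≤ ∫ ω, |r| * |ξ ω - η ω| ∂P := by
        refine norm_integral_le_of_norm_le (hd.abs.const_mul _) (Eventually.of_forall fun ω => ?_)
        refine (norm_exp_mul_I_sub_le _ _).trans (le_of_eq ?_)
        rw [← mul_sub, abs_mul]
    _ = |r| * ∫ ω, |ξ ω - η ω| ∂P := integral_const_mul _ _
    _ ≤ |r| * ‖ξ - η‖ := by
        gcongr
        have h1 : ∫ ω, |ξ ω - η ω| ∂P = (eLpNorm (fun ω => ξ ω - η ω) 1 P).toReal := by
          rw [eLpNorm_one_eq_lintegral_enorm, ← integral_norm_eq_lintegral_enorm hd.1]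
          rfl
        rw [h1, Lp.norm_def]
        refine ENNReal.toReal_mono (Lp.eLpNorm_ne_top _) ?_
        rw [eLpNorm_congr_ae (Lp.coeFn_sub ξ η)]
        exact eLpNorm_le_eLpNorm_of_exponent_le (by norm_num) hd.1
    _ = _ := by simp [dist_eq_norm]

/-- For each frequency, the Gaussian formula for the characteristic function is a closed condition
on the variable. It holds on the span, hence on its closure. -/
theorem map_eq_gaussianReal_of_mem_closure_span {P : Measure Ω} {T : Type*} {Z : T → Ω → ℝ}
    (hZ : IsGaussianProcess Z P) (h0 : ∀ t, ∫ ω, Z t ω ∂P = 0) {z : T → Lp ℝ 2 P}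
    (hz : ∀ t, z t =ᵐ[P] Z t) {ξ : Lp ℝ 2 P}
    (hξ : ξ ∈ (Submodule.span ℝ (Set.range z)).topologicalClosure) :
    P.map ξ = gaussianReal 0 (‖ξ‖₊ ^ 2) := by
  have := hZ.isProbabilityMeasure
  have : IsProbabilityMeasure (P.map ξ) :=
    Measure.isProbabilityMeasure_map (Lp.aestronglyMeasurable ξ).aemeasurable
  refine Measure.ext_of_charFun (funext fun r => ?_)
  have hcl : IsClosed {η : Lp ℝ 2 P | charFun (P.map η) r
      = Complex.exp (-(((‖η‖ ^ 2 * r ^ 2 / 2 : ℝ)) : ℂ))} :=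
    isClosed_eq (continuous_charFun_map r) (by fun_prop)
  have hsub : ((Submodule.span ℝ (Set.range z)) : Set (Lp ℝ 2 P)) ⊆ {η : Lp ℝ 2 P |
      charFun (P.map η) r = Complex.exp (-(((‖η‖ ^ 2 * r ^ 2 / 2 : ℝ)) : ℂ))} := by
    intro η hη
    rw [Set.mem_ofPred_eq, map_eq_gaussianReal_of_mem_span hZ h0 hz hη, charFun_gaussianReal]
    simp
  have h := closure_minimal hsub hcl hξ
  rw [Set.mem_ofPred_eq] at h
  rw [h, charFun_gaussianReal]
  simp

theorem integral_pow_four_gaussianReal (v : NNReal) :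
    ∫ x, x ^ 4 ∂gaussianReal 0 v = 3 * (v : ℝ) ^ 2 := by
  have h1 : ∫ x, x ^ 4 ∂gaussianReal 0 v
      = iteratedDeriv 4 (mgf (fun x ↦ x) (gaussianReal 0 v)) 0 := by
    rw [iteratedDeriv_mgf_zero] <;> simp
  -- Differentiating `p e^{v t²/2}` replaces `p` by `p' + v t p`; four rounds starting from `p = 1`
  -- give a polynomial whose value at `0` is `3 v²`.
  have hd : ∀ (p p' : ℝ → ℝ), (∀ t, HasDerivAt p (p' t) t) →
      deriv (fun t ↦ p t * Real.exp (v * t ^ 2 / 2))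
        = fun t ↦ (p' t + p t * (v * t)) * Real.exp (v * t ^ 2 / 2) := by
    intro p p' hp
    ext t
    have he : HasDerivAt (fun t : ℝ ↦ Real.exp (v * t ^ 2 / 2))
        (Real.exp (v * t ^ 2 / 2) * (v * t)) t := by
      have := (((hasDerivAt_pow 2 t).const_mul (v : ℝ)).div_const 2).exp
      convert this using 1
      simp
      ring_nf
    refine ((hp t).mul he).deriv.trans ?_
    ring
  have e0 : mgf (fun x ↦ x) (gaussianReal 0 v)
      = fun t ↦ (1 : ℝ) * Real.exp (v * t ^ 2 / 2) := by
    rw [mgf_fun_id_gaussianReal]; ext t; simp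
  have e1 := hd (fun _ => 1) (fun _ => 0) (fun t => hasDerivAt_const t 1)
  have e2 := hd (fun t => v * t) (fun _ => v)
    (fun t => by simpa using (hasDerivAt_id t).const_mul (v : ℝ))
  have e3 := hd (fun t => v + v ^ 2 * t ^ 2) (fun t => 2 * v ^ 2 * t)
    (fun t => by
      have := ((hasDerivAt_pow 2 t).const_mul ((v : ℝ) ^ 2)).const_add (v : ℝ)
      exact this.congr_deriv (by norm_num; ring))
  have e4 := hd (fun t => 3 * v ^ 2 * t + v ^ 3 * t ^ 3) (fun t => 3 * v ^ 2 + 3 * v ^ 3 * t ^ 2)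
    (fun t => by
      have := ((hasDerivAt_id t).const_mul (3 * (v : ℝ) ^ 2)).add
        ((hasDerivAt_pow 3 t).const_mul ((v : ℝ) ^ 3))
      exact this.congr_deriv (by norm_num; ring))
  rw [h1, iteratedDeriv_succ, iteratedDeriv_succ, iteratedDeriv_succ, iteratedDeriv_one, e0, e1]
  have f1 : (fun t : ℝ ↦ (0 + 1 * (v * t)) * Real.exp (v * t ^ 2 / 2))
      = fun t ↦ (v * t) * Real.exp (v * t ^ 2 / 2) := by ext t; ring
  rw [f1, e2]
  have f2 : (fun t : ℝ ↦ ((v : ℝ) + (v * t) * (v * t)) * Real.exp (v * t ^ 2 / 2))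
      = fun t ↦ (v + v ^ 2 * t ^ 2) * Real.exp (v * t ^ 2 / 2) := by ext t; ring
  rw [f2, e3]
  have f3 : (fun t : ℝ ↦ (2 * (v : ℝ) ^ 2 * t + (v + v ^ 2 * t ^ 2) * (v * t))
        * Real.exp (v * t ^ 2 / 2))
      = fun t ↦ (3 * v ^ 2 * t + v ^ 3 * t ^ 3) * Real.exp (v * t ^ 2 / 2) := by ext t; ring
  rw [f3, e4]
  simp

theorem memLp_of_map_eq_gaussianReal {P : Measure Ω} {ξ : Ω → ℝ} {v : NNReal}
    (hm : AEMeasurable ξ P) (h : P.map ξ = gaussianReal 0 v) (p : ℝ≥0∞) (hp : p ≠ ∞) :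
    MemLp ξ p P := by
  have := memLp_id_gaussianReal' (μ := 0) (v := v) p hp
  rw [← h] at this
  exact (memLp_map_measure_iff aestronglyMeasurable_id hm).1 this

/-- A linear space of square integrable random variables all of which are centred Gaussian. -/
def IsGaussianSpace {P : Measure Ω} (G : Submodule ℝ (Lp ℝ 2 P)) : Prop :=
  ∀ ξ ∈ G, P.map ξ = gaussianReal 0 (‖ξ‖₊ ^ 2)

/-! ### Moments of order four in a Gaussian space -/

section Wick

variable {P : Measure Ω} {G : Submodule ℝ (Lp ℝ 2 P)}

theorem IsGaussianSpace.memLp (hG : IsGaussianSpace G) {ξ : Lp ℝ 2 P} (hξ : ξ ∈ G)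
    (p : ℝ≥0∞) (hp : p ≠ ∞) : MemLp ξ p P :=
  memLp_of_map_eq_gaussianReal (Lp.aestronglyMeasurable ξ).aemeasurable (hG ξ hξ) p hp

theorem IsGaussianSpace.memLp_mul (hG : IsGaussianSpace G) {ξ η : Lp ℝ 2 P} (hξ : ξ ∈ G)
    (hη : η ∈ G) : MemLp (fun ω => ξ ω * η ω) 2 P := by
  have : ENNReal.HolderTriple 4 4 2 := ⟨by
    rw [← two_mul, show (4 : ℝ≥0∞) = 2 * 2 by norm_num,
      ENNReal.mul_inv (by norm_num) (by norm_num), ← mul_assoc,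
      ENNReal.mul_inv_cancel (by norm_num) (by norm_num), one_mul]⟩
  exact MemLp.mul' (p := 4) (q := 4) (hG.memLp hη 4 (by norm_num)) (hG.memLp hξ 4 (by norm_num))

theorem IsGaussianSpace.integrable_mul_mul_mul (hG : IsGaussianSpace G) {a b c d : Lp ℝ 2 P}
    (ha : a ∈ G) (hb : b ∈ G) (hc : c ∈ G) (hd : d ∈ G) :
    Integrable (fun ω => a ω * b ω * c ω * d ω) P := by
  simp_rw [mul_assoc (_ * _)]
  exact (hG.memLp_mul ha hb).integrable_mul (hG.memLp_mul hc hd)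

theorem IsGaussianSpace.integral_pow_four (hG : IsGaussianSpace G) {ξ : Lp ℝ 2 P} (hξ : ξ ∈ G) :
    ∫ ω, ξ ω ^ 4 ∂P = 3 * (inner ℝ ξ ξ) ^ 2 := by
  have h := integral_pow_four_gaussianReal (‖ξ‖₊ ^ 2)
  rw [← hG ξ hξ, integral_map (Lp.aestronglyMeasurable ξ).aemeasurable (by fun_prop)] at h
  rw [h, real_inner_self_eq_norm_sq]
  simp

/-- Wick's formula for the fourth mixed moment. -/
theorem IsGaussianSpace.integral_mul_mul_mul (hG : IsGaussianSpace G) {a b c d : Lp ℝ 2 P}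
    (ha : a ∈ G) (hb : b ∈ G) (hc : c ∈ G) (hd : d ∈ G) :
    ∫ ω, a ω * b ω * c ω * d ω ∂P
      = inner ℝ a b * inner ℝ c d + inner ℝ a c * inner ℝ b d + inner ℝ a d * inner ℝ b c := by
  let L : ℝ → ℝ → ℝ → Lp ℝ 2 P := fun x y z => a + x • b + y • c + z • d
  have hL : ∀ x y z, L x y z ∈ G := fun x y z =>
    G.add_mem (G.add_mem (G.add_mem ha (G.smul_mem x hb)) (G.smul_mem y hc)) (G.smul_mem z hd)
  have hLc : ∀ x y z, ∀ᵐ ω ∂P, L x y z ω = a ω + x * b ω + y * c ω + z * d ω := by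
    intro x y z
    filter_upwards [Lp.coeFn_add (a + x • b + y • c) (z • d), Lp.coeFn_add (a + x • b) (y • c),
      Lp.coeFn_add a (x • b), Lp.coeFn_smul x b, Lp.coeFn_smul y c, Lp.coeFn_smul z d]
      with ω h1 h2 h3 h4 h5 h6
    simp only [L, h1, h2, h3, h4, h5, h6, Pi.add_apply, Pi.smul_apply, smul_eq_mul]
  have hi : ∀ x y z, Integrable (fun ω => L x y z ω ^ 4) P := by
    intro x y z
    have := hG.integrable_mul_mul_mul (hL x y z) (hL x y z) (hL x y z) (hL x y z)
    refine this.congr (Eventually.of_forall fun ω => ?_)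
    simp only; ring
  -- Polarization: summing `(a ± b ± c ± d)⁴` over the eight sign choices, weighted by the product
  -- of the signs, keeps only `abcd`, with coefficient `8 · 4! = 192`. This reduces the mixed moment
  -- to fourth moments of single Gaussian variables.
  have pol : ∀ᵐ ω ∂P, a ω * b ω * c ω * d ω = (1 / 192) *
      (L 1 1 1 ω ^ 4 - L 1 1 (-1) ω ^ 4 - L 1 (-1) 1 ω ^ 4 + L 1 (-1) (-1) ω ^ 4
      - L (-1) 1 1 ω ^ 4 + L (-1) 1 (-1) ω ^ 4 + L (-1) (-1) 1 ω ^ 4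
      - L (-1) (-1) (-1) ω ^ 4) := by
    filter_upwards [hLc 1 1 1, hLc 1 1 (-1), hLc 1 (-1) 1, hLc 1 (-1) (-1), hLc (-1) 1 1,
      hLc (-1) 1 (-1), hLc (-1) (-1) 1, hLc (-1) (-1) (-1)] with ω h1 h2 h3 h4 h5 h6 h7 h8
    rw [h1, h2, h3, h4, h5, h6, h7, h8]
    ring
  have hI : ∀ x y z, inner ℝ (L x y z) (L x y z) = inner ℝ a a + x ^ 2 * inner ℝ b b
      + y ^ 2 * inner ℝ c c + z ^ 2 * inner ℝ d d + 2 * (x * inner ℝ a b + y * inner ℝ a c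
      + z * inner ℝ a d + x * y * inner ℝ b c + x * z * inner ℝ b d + y * z * inner ℝ c d) := by
    intro x y z
    simp only [L, inner_add_left, inner_add_right, real_inner_smul_left, real_inner_smul_right]
    rw [real_inner_comm a b, real_inner_comm a c, real_inner_comm a d, real_inner_comm b c,
      real_inner_comm b d, real_inner_comm c d]
    ring
  have hq : ∀ x y z, ∫ ω, L x y z ω ^ 4 ∂P = 3 * (inner ℝ a a + x ^ 2 * inner ℝ b b
      + y ^ 2 * inner ℝ c c + z ^ 2 * inner ℝ d d + 2 * (x * inner ℝ a b + y * inner ℝ a c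
      + z * inner ℝ a d + x * y * inner ℝ b c + x * z * inner ℝ b d
      + y * z * inner ℝ c d)) ^ 2 := by
    intro x y z
    rw [hG.integral_pow_four (hL x y z), hI]
  rw [integral_congr_ae pol, integral_const_mul, integral_sub, integral_add, integral_add,
    integral_sub, integral_add, integral_sub, integral_sub]
  · simp only [hq]
    ring
  all_goals
    repeat first
      | exact hi _ _ _
      | refine Integrable.sub ?_ (hi _ _ _)
      | refine Integrable.add ?_ (hi _ _ _)

end Wick

/-! ### Characters -/

/-- The character `e^{i r x}`. -/
def chr (r x : ℝ) : ℂ := Complex.exp (Complex.I * r * x)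

theorem norm_chr (r x : ℝ) : ‖chr r x‖ = 1 := by
  rw [chr, show Complex.I * r * x = ((r * x : ℝ) : ℂ) * Complex.I by push_cast; ring,
    Complex.norm_exp_ofReal_mul_I]

theorem chr_add (r s x : ℝ) : chr (r + s) x = chr r x * chr s x := by
  rw [chr, chr, chr, ← Complex.exp_add]
  congr 1; push_cast; ring

theorem chr_zero (x : ℝ) : chr 0 x = 1 := by simp [chr]

theorem conj_chr (r x : ℝ) : (starRingEnd ℂ) (chr r x) = chr (-r) x := by
  rw [chr, chr, ← Complex.exp_conj]
  simp

theorem chr_mul_chr_neg (r x : ℝ) : chr r x * chr (-r) x = 1 := by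
  rw [← chr_add, add_neg_cancel, chr_zero]

theorem continuous_chr : Continuous fun p : ℝ × ℝ => chr p.1 p.2 := by
  unfold chr; fun_prop

theorem _root_.Continuous.chr {α : Type*} [TopologicalSpace α] {u v : α → ℝ} (hu : Continuous u)
    (hv : Continuous v) : Continuous fun y => Correlogram.chr (u y) (v y) :=
  continuous_chr.comp (hu.prodMk hv)

theorem integrable_chr_mul {φ : ℝ → ℂ} (hφ : Integrable φ) (r : ℝ) :
    Integrable fun x => chr r x * φ x :=
  hφ.bdd_mul (c := 1) (continuous_const.chr continuous_id).aestronglyMeasurable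
    (Eventually.of_forall fun x => (norm_chr r x).le)

theorem memLp_chr_mul {φ : ℝ → ℂ} {p : ℝ≥0∞} (hφ : MemLp φ p volume) (r : ℝ) :
    MemLp (fun x => chr r x * φ x) p volume := by
  refine hφ.of_le ((continuous_const.chr continuous_id).aestronglyMeasurable.mul hφ.1)
    (Eventually.of_forall fun x => ?_)
  rw [norm_mul, norm_chr, one_mul]

theorem continuous_integral_chr_mul {φ : ℝ → ℂ} (hφ : Integrable φ) :
    Continuous fun r => ∫ x, chr r x * φ x := by
  refine continuous_of_dominated (bound := fun x => ‖φ x‖)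
    (fun r => (integrable_chr_mul hφ r).1) (fun r => ?_) hφ.norm ?_
  · exact Eventually.of_forall fun x => by rw [norm_mul, norm_chr, one_mul]
  · exact Eventually.of_forall fun x =>
      (continuous_id.chr continuous_const).mul continuous_const

/-- Used when the arguments of a real inner product are exchanged: the spectrum is conjugated and
the lag changes sign. -/
theorem ofReal_eq_integral_conj {α : Type*} [MeasurableSpace α] {μ : Measure α} {q : ℝ}
    {F : α → ℂ} (h : (q : ℂ) = ∫ x, F x ∂μ) :
    (q : ℂ) = ∫ x, (starRingEnd ℂ) (F x) ∂μ := by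
  rw [integral_conj, ← h, Complex.conj_ofReal]

theorem angularFourier_eq_integral_chr (h : ℝ → ℝ) (x : ℝ) :
    angularFourier h x = ∫ s, chr (-s) x * h s := by
  unfold angularFourier chr
  congr 1; ext s; congr 2; push_cast; ring

/-! ### Dominated convergence in `L²` -/

theorem tendsto_eLpNorm_two_of_dominated {α E ι : Type*} [MeasurableSpace α] {μ : Measure α}
    [NormedAddCommGroup E] {l : Filter ι} [l.IsCountablyGenerated] {u : ι → α → E} {u₀ : α → E}
    {B : α → ℝ} (hB : MemLp B 2 μ) (hu : ∀ᶠ i in l, AEStronglyMeasurable (u i - u₀) μ)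
    (hb : ∀ᶠ i in l, ∀ᵐ x ∂μ, ‖u i x - u₀ x‖ ≤ B x)
    (hlim : ∀ᵐ x ∂μ, Tendsto (fun i => u i x) l (𝓝 (u₀ x))) :
    Tendsto (fun i => eLpNorm (u i - u₀) 2 μ) l (𝓝 0) := by
  have h : Tendsto (fun i => ∫⁻ x, ‖u i x - u₀ x‖ₑ ^ (2 : ℝ) ∂μ) l (𝓝 (∫⁻ _, 0 ∂μ)) := by
    refine tendsto_lintegral_filter_of_dominated_convergence'
      (fun x => ‖B x‖ₑ ^ (2 : ℝ)) ?_ ?_ ?_ ?_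
    · filter_upwards [hu] with i hi
      exact hi.enorm.pow_const _
    · filter_upwards [hb] with i hi
      filter_upwards [hi] with x hx
      gcongr
      refine enorm_le_iff_norm_le.2 (hx.trans (le_abs_self _))
    · have := hB.2
      rw [eLpNorm_lt_top_iff_lintegral_rpow_enorm_lt_top (by norm_num) (by norm_num)] at this
      simpa using this.ne
    · filter_upwards [hlim] with x hx
      have h1 : Tendsto (fun i => ‖u i x - u₀ x‖ₑ) l (𝓝 0) := by
        have := (hx.sub_const (u₀ x)).enorm
        simpa using this
      have := h1.ennrpow_const 2
      simpa using this
  have h2 := h.ennrpow_const (1 / 2)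
  rw [lintegral_zero, ENNReal.zero_rpow_of_pos (by norm_num)] at h2
  refine h2.congr fun i => ?_
  rw [eLpNorm_eq_lintegral_rpow_enorm_toReal (by norm_num) (by norm_num)]
  simp

theorem exists_tendsto_of_dist_le {ι E F : Type*} [PseudoMetricSpace E] [CompleteSpace E]
    [PseudoMetricSpace F] {l : Filter ι} [l.NeBot] {v : ι → E} {w : ι → F} {w₀ : F} {C : ℝ}
    (h : ∀ᶠ p in l ×ˢ l, dist (v p.1) (v p.2) ≤ C * dist (w p.1) (w p.2))
    (hw : Tendsto w l (𝓝 w₀)) : ∃ v₀, Tendsto v l (𝓝 v₀) := by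
  refine cauchy_map_iff_exists_tendsto.1 (cauchy_map_iff.2 ⟨inferInstance, ?_⟩)
  rw [Metric.uniformity_eq_comap_nhds_zero, tendsto_comap_iff]
  have h2 : Tendsto (fun p : ι × ι => C * dist (w p.1) (w p.2)) (l ×ˢ l) (𝓝 0) := by
    have h3 : Tendsto (fun p : ι × ι => dist (w p.1) (w p.2)) (l ×ˢ l) (𝓝 (dist w₀ w₀)) :=
      (hw.comp tendsto_fst).dist (hw.comp tendsto_snd)
    simpa using h3.const_mul C
  exact squeeze_zero' (Eventually.of_forall fun _ => dist_nonneg) h h2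

theorem memLp_two_of_bounded {f : ℝ → ℝ} {M : ℝ} (hf : Integrable f) (h0 : ∀ y, 0 ≤ f y)
    (hM : ∀ y, f y ≤ M) : MemLp f 2 volume := by
  refine (memLp_two_iff_integrable_sq hf.1).2 ?_
  refine (hf.const_mul M).mono' (hf.1.pow 2) (Eventually.of_forall fun y => ?_)
  rw [Real.norm_of_nonneg (by positivity), sq]
  exact mul_le_mul_of_nonneg_right (hM y) (h0 y)

/-! ### Stationary curves in a Hilbert space -/

section Hilbert

variable {E : Type*} [NormedAddCommGroup E] [InnerProductSpace ℝ E]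

/-- Expanding `‖x s - x t‖²` leaves only inner products, which cancel in the limit `s → t`. -/
theorem continuous_of_continuous_inner {x : ℝ → E}
    (h : Continuous fun p : ℝ × ℝ => inner ℝ (x p.1) (x p.2)) : Continuous x := by
  rw [continuous_iff_continuousAt]
  intro t
  rw [ContinuousAt, tendsto_iff_norm_sub_tendsto_zero]
  have h1 : Tendsto (fun s => inner ℝ (x s) (x s) - 2 * inner ℝ (x s) (x t) + inner ℝ (x t) (x t))
      (𝓝 t) (𝓝 0) := by
    have hc : Continuous fun s =>
        inner ℝ (x s) (x s) - 2 * inner ℝ (x s) (x t) + inner ℝ (x t) (x t) :=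
      ((h.comp (continuous_id.prodMk continuous_id)).sub (continuous_const.mul
        (h.comp (continuous_id.prodMk continuous_const)))).add continuous_const
    have := hc.tendsto t
    convert this using 2
    ring
  have h2 := h1.sqrt
  rw [Real.sqrt_zero] at h2
  refine h2.congr fun s => ?_
  rw [real_inner_self_eq_norm_sq, real_inner_self_eq_norm_sq, ← norm_sub_sq_real,
    Real.sqrt_sq (norm_nonneg _)]

/-- `x` is a stationary curve with spectral density `f`. -/
structure HasSpectralDensity (x : ℝ → E) (f : ℝ → ℝ) : Prop where
  nonneg : ∀ y, 0 ≤ f y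
  integrable : Integrable f
  inner_eq : ∀ s t : ℝ, ((inner ℝ (x s) (x t) : ℝ) : ℂ) = ∫ y, chr (s - t) y * f y

variable {x : ℝ → E} {f : ℝ → ℝ}

theorem HasSpectralDensity.integrable_ofReal (hx : HasSpectralDensity x f) :
    Integrable fun y => (f y : ℂ) := hx.integrable.ofReal

theorem HasSpectralDensity.continuous (hx : HasSpectralDensity x f) : Continuous x := by
  refine continuous_of_continuous_inner ?_
  have h : Continuous fun p : ℝ × ℝ => ((inner ℝ (x p.1) (x p.2) : ℝ) : ℂ) := by
    simp_rw [hx.inner_eq]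
    exact (continuous_integral_chr_mul hx.integrable.ofReal).comp
      (continuous_fst.sub continuous_snd)
  exact (Complex.continuous_re.comp h).congr fun p => Complex.ofReal_re _

theorem HasSpectralDensity.norm_eq (hx : HasSpectralDensity x f) (t : ℝ) : ‖x t‖ = ‖x 0‖ := by
  have h : inner ℝ (x t) (x t) = inner ℝ (x 0) (x 0) := by
    have : ((inner ℝ (x t) (x t) : ℝ) : ℂ) = (inner ℝ (x 0) (x 0) : ℝ) := by
      rw [hx.inner_eq, hx.inner_eq, sub_self, sub_self]
    exact_mod_cast this
  rw [real_inner_self_eq_norm_sq, real_inner_self_eq_norm_sq] at h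
  exact (sq_eq_sq₀ (norm_nonneg _) (norm_nonneg _)).1 h

/-- The filtered curve `∫ h(s) x(t - s) ds`. -/
def filtered (x : ℝ → E) (h : ℝ → ℝ) (t : ℝ) : E := ∫ s, h s • x (t - s)

theorem HasSpectralDensity.integrable_smul (hx : HasSpectralDensity x f) {h : ℝ → ℝ}
    (hh : Integrable h) (t : ℝ) : Integrable fun s => h s • x (t - s) := by
  refine hh.smul_bdd (C := ‖x 0‖)  ?_ (Eventually.of_forall fun s => (hx.norm_eq _).le)
  have := hx.continuous
  exact (by fun_prop : Continuous fun s => x (t - s)).aestronglyMeasurable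

theorem HasSpectralDensity.filtered_sub (hx : HasSpectralDensity x f) {h k : ℝ → ℝ}
    (hh : Integrable h) (hk : Integrable k) (t : ℝ) :
    filtered x (h - k) t = filtered x h t - filtered x k t := by
  unfold filtered
  rw [← integral_sub (hx.integrable_smul hh t) (hx.integrable_smul hk t)]
  simp [sub_smul]

variable [CompleteSpace E]

theorem HasSpectralDensity.inner_filtered (hx : HasSpectralDensity x f) {h : ℝ → ℝ}
    (hh : Integrable h) (t : ℝ) (z : E) :
    inner ℝ (filtered x h t) z = ∫ s, h s * inner ℝ (x (t - s)) z := by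
  rw [real_inner_comm, filtered, ← integral_inner (hx.integrable_smul hh t)]
  simp_rw [real_inner_smul_right, real_inner_comm]

/-- Filtering multiplies a cross-spectrum by the transfer function, by Fubini. Here `φ` is the
cross-spectrum of the curve with a fixed vector `z`; allowing arbitrary `z` lets the formula be
applied again with `z` itself filtered. -/
theorem HasSpectralDensity.inner_filtered_eq (hx : HasSpectralDensity x f) {h : ℝ → ℝ}
    (hh : Integrable h) {z : E} {φ : ℝ → ℂ} (hφ : Integrable φ)
    (hz : ∀ r, ((inner ℝ (x r) z : ℝ) : ℂ) = ∫ y, chr r y * φ y) (t : ℝ) :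
    ((inner ℝ (filtered x h t) z : ℝ) : ℂ) = ∫ y, chr t y * (angularFourier h y * φ y) := by
  rw [hx.inner_filtered hh, ← integral_complex_ofReal]
  simp_rw [Complex.ofReal_mul, hz, ← integral_const_mul]
  rw [integral_integral_swap]
  · refine integral_congr_ae (Eventually.of_forall fun y => ?_)
    simp only
    rw [angularFourier_eq_integral_chr, ← integral_mul_const, ← integral_const_mul]
    refine integral_congr_ae (Eventually.of_forall fun s => ?_)
    simp only
    rw [sub_eq_add_neg, chr_add]
    ring
  · have h1 : Integrable (fun p : ℝ × ℝ => (h p.1 : ℂ) * φ p.2) (volume.prod volume) :=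
      hh.ofReal.mul_prod hφ
    have h2 := h1.bdd_mul (c := 1) (f := fun p : ℝ × ℝ => chr (t - p.1) p.2)
      ((continuous_const.sub continuous_fst).chr continuous_snd).aestronglyMeasurable
      (Eventually.of_forall fun p => (norm_chr _ _).le)
    refine h2.congr (Eventually.of_forall fun p => ?_)
    simp only [Function.uncurry]
    ring

/-- Applying the cross-spectrum formula twice gives `‖filtered x h t‖² = ∫ |h*|² f`, and then `f ≤
M` with Plancherel. This bound extends filtering from `L¹ ∩ L²` to `L²`. -/
theorem HasSpectralDensity.norm_filtered_sq_le (hx : HasSpectralDensity x f) {M : ℝ}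
    (hM : ∀ y, f y ≤ M) {h : ℝ → ℝ} (h1 : Integrable h) (h2 : MemLp h 2 volume) (t : ℝ) :
    ‖filtered x h t‖ ^ 2 ≤ M * (2 * Real.pi * ∫ s, h s ^ 2) := by
  have hm := (continuous_angularFourier h1).aestronglyMeasurable (μ := volume)
  have e1 : ∀ r, ((inner ℝ (x r) (filtered x h t) : ℝ) : ℂ)
      = ∫ y, chr r y * (chr (-t) y * ((starRingEnd ℂ) (angularFourier h y) * f y)) := by
    intro r
    rw [real_inner_comm]
    have := hx.inner_filtered_eq h1 (z := x r) (φ := fun y => chr (-r) y * f y)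
      (integrable_chr_mul hx.integrable.ofReal _)
      (fun q => by rw [hx.inner_eq]; simp_rw [sub_eq_add_neg, chr_add, mul_assoc]) t
    rw [ofReal_eq_integral_conj this]
    refine integral_congr_ae (Eventually.of_forall fun y => ?_)
    simp only [map_mul, conj_chr, Complex.conj_ofReal, neg_neg]
    ring
  have hi : Integrable fun y => (starRingEnd ℂ) (angularFourier h y) * f y :=
    hx.integrable.ofReal.bdd_mul (c := ∫ s, |h s|)
      (Complex.continuous_conj.comp_aestronglyMeasurable hm)
      (Eventually.of_forall fun y => by
        rw [RCLike.norm_conj]; exact norm_angularFourier_le h y)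
  have e2 := hx.inner_filtered_eq h1 (integrable_chr_mul hi (-t)) e1 t
  have e3 : ‖filtered x h t‖ ^ 2 = ∫ y, ‖angularFourier h y‖ ^ 2 * f y := by
    rw [← real_inner_self_eq_norm_sq]
    have : ((inner ℝ (filtered x h t) (filtered x h t) : ℝ) : ℂ)
        = ((∫ y, ‖angularFourier h y‖ ^ 2 * f y : ℝ) : ℂ) := by
      rw [e2, ← integral_complex_ofReal]
      refine integral_congr_ae (Eventually.of_forall fun y => ?_)
      simp only
      push_cast
      rw [← Complex.mul_conj']
      calc _ = (chr t y * chr (-t) y) *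
            (angularFourier h y * (starRingEnd ℂ) (angularFourier h y) * f y) := by ring
        _ = _ := by rw [chr_mul_chr_neg, one_mul]
    exact_mod_cast this
  rw [e3, ← integral_norm_sq_angularFourier h1 h2, ← integral_const_mul]
  have hsq : Integrable fun y => ‖angularFourier h y‖ ^ 2 :=
    (memLp_angularFourier h1 h2).integrable_norm_pow (by norm_num)
  refine integral_mono_of_nonneg (Eventually.of_forall fun y => ?_) (hsq.const_mul M)
    (Eventually.of_forall fun y => ?_)
  · exact mul_nonneg (by positivity) (hx.nonneg y)
  · simp only
    rw [mul_comm]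
    exact mul_le_mul_of_nonneg_right (hM y) (by positivity)

/-- The restriction of `H` to the interval `(p.1, p.2]`. -/
def window (H : ℝ → ℝ) (p : ℝ × ℝ) : ℝ → ℝ := (Ioc p.1 p.2).indicator H

theorem memLp_window {H : ℝ → ℝ} (hH : MemLp H 2 volume) (p : ℝ × ℝ) :
    MemLp (window H p) 2 volume := hH.indicator measurableSet_Ioc

theorem integrable_window {H : ℝ → ℝ} (hH : MemLp H 2 volume) (p : ℝ × ℝ) :
    Integrable (window H p) := by
  refine (integrable_indicator_iff measurableSet_Ioc).2 ?_
  exact (hH.restrict (Ioc p.1 p.2)).integrable (by norm_num)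

theorem tendsto_eLpNorm_window {H : ℝ → ℝ} (hH : MemLp H 2 volume) :
    Tendsto (fun p => eLpNorm (window H p - H) 2 volume) (atBot ×ˢ atTop) (𝓝 0) := by
  refine tendsto_eLpNorm_two_of_dominated hH.norm
    (Eventually.of_forall fun p => ((memLp_window hH p).sub hH).1)
    (Eventually.of_forall fun p => Eventually.of_forall fun s => ?_)
    (Eventually.of_forall fun s => ?_)
  · by_cases hs : s ∈ Ioc p.1 p.2 <;> simp [window, hs]
  · refine tendsto_const_nhds.congr' ?_
    have h1 : ∀ᶠ p : ℝ × ℝ in atBot ×ˢ atTop, p.1 < s :=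
      tendsto_fst.eventually (eventually_lt_atBot s)
    have h2 : ∀ᶠ p : ℝ × ℝ in atBot ×ˢ atTop, s ≤ p.2 :=
      tendsto_snd.eventually (eventually_ge_atTop s)
    filter_upwards [h1, h2] with p hp1 hp2
    have : s ∈ Ioc p.1 p.2 := ⟨hp1, hp2⟩
    simp [window, this]

/-- The windows of `H` converge in `L²(ℝ)`, and filtering is Lipschitz from `L²(ℝ)` to `E`, so the
filtered vectors are Cauchy. -/
theorem HasSpectralDensity.exists_tendsto_filtered (hx : HasSpectralDensity x f) {M : ℝ}
    (hM : ∀ y, f y ≤ M) {H : ℝ → ℝ} (hH : MemLp H 2 volume) (t : ℝ) :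
    ∃ v, Tendsto (fun p => filtered x (window H p) t) (atBot ×ˢ atTop) (𝓝 v) := by
  have hM0 : 0 ≤ M := (hx.nonneg 0).trans (hM 0)
  have hw : Tendsto (fun p => (memLp_window hH p).toLp (window H p)) (atBot ×ˢ atTop)
      (𝓝 (hH.toLp H)) :=
    (Lp.tendsto_Lp_iff_tendsto_eLpNorm'' _ _ _ _).2 (tendsto_eLpNorm_window hH)
  refine exists_tendsto_of_dist_le (C := √(M * (2 * Real.pi)))
    (Eventually.of_forall fun p => ?_) hw
  rw [dist_eq_norm, dist_eq_norm,
    ← hx.filtered_sub (integrable_window hH _) (integrable_window hH _), ← MemLp.toLp_sub,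
    Lp.norm_toLp]
  have hs := (memLp_window hH p.1).sub (memLp_window hH p.2)
  have h1 := hx.norm_filtered_sq_le hM ((integrable_window hH p.1).sub (integrable_window hH p.2))
    hs t
  have h2 := integral_norm_sq_eq_eLpNorm hs
  simp only [Real.norm_eq_abs, sq_abs] at h2
  rw [h2, ← mul_assoc] at h1
  refine le_of_sq_le_sq (h1.trans (le_of_eq ?_)) (by positivity)
  rw [mul_pow, Real.sq_sqrt (by positivity)]

/-- The mean-square limit of the filtered curves over growing windows. -/
def fullFiltered (x : ℝ → E) (H : ℝ → ℝ) (t : ℝ) : E :=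
  limUnder (atBot ×ˢ atTop) fun p => filtered x (window H p) t

theorem HasSpectralDensity.tendsto_filtered (hx : HasSpectralDensity x f) {M : ℝ}
    (hM : ∀ y, f y ≤ M) {H : ℝ → ℝ} (hH : MemLp H 2 volume) (t : ℝ) :
    Tendsto (fun p => filtered x (window H p) t) (atBot ×ˢ atTop) (𝓝 (fullFiltered x H t)) :=
  tendsto_nhds_limUnder (hx.exists_tendsto_filtered hM hH t)

/-- Limit of the windowed formula. The transforms of the windows converge only in `L²`, which is why
`φ` must be square integrable as well as integrable. -/
theorem HasSpectralDensity.inner_fullFiltered_eq (hx : HasSpectralDensity x f) {M : ℝ}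
    (hM : ∀ y, f y ≤ M) {H : ℝ → ℝ} (hH : MemLp H 2 volume) {z : E} {φ : ℝ → ℂ}
    (hφ : Integrable φ) (hφ2 : MemLp φ 2 volume)
    (hz : ∀ r, ((inner ℝ (x r) z : ℝ) : ℂ) = ∫ y, chr r y * φ y) (t : ℝ) :
    ((inner ℝ (fullFiltered x H t) z : ℝ) : ℂ) = ∫ y, chr t y * (plancherel H hH y * φ y) := by
  have h1 : Tendsto (fun p => ((inner ℝ (filtered x (window H p) t) z : ℝ) : ℂ)) (atBot ×ˢ atTop)
      (𝓝 ((inner ℝ (fullFiltered x H t) z : ℝ) : ℂ)) :=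
    (Complex.continuous_ofReal.tendsto _).comp
      ((hx.tendsto_filtered hM hH t).inner tendsto_const_nhds)
  have h2 : Tendsto (fun p => ∫ y, plancherel (window H p) (memLp_window hH p) y * (chr t y * φ y))
      (atBot ×ˢ atTop) (𝓝 (∫ y, plancherel H hH y * (chr t y * φ y))) := by
    refine tendsto_integral_mul_of_tendsto_eLpNorm (fun p => memLp_plancherel _ _)
      (fun _ => memLp_chr_mul hφ2 t) (memLp_plancherel _ _) (memLp_chr_mul hφ2 t) ?_ ?_
    · simp_rw [eLpNorm_plancherel_sub]
      have := ENNReal.Tendsto.const_mul (a := ENNReal.ofReal (2 * Real.pi) ^ (1 / 2 : ℝ))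
        (tendsto_eLpNorm_window hH)
        (Or.inr (ENNReal.rpow_ne_top_of_nonneg (by norm_num) ENNReal.ofReal_ne_top))
      simpa using this
    · simp
  have h3 : ∀ p, ((inner ℝ (filtered x (window H p) t) z : ℝ) : ℂ)
      = ∫ y, plancherel (window H p) (memLp_window hH p) y * (chr t y * φ y) := by
    intro p
    rw [hx.inner_filtered_eq (integrable_window hH p) hφ hz]
    refine integral_congr_ae ?_
    filter_upwards [plancherel_ae_eq_angularFourier (integrable_window hH p) (memLp_window hH p)]
      with y hy
    rw [hy]; ring
  simp_rw [h3] at h1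
  rw [tendsto_nhds_unique h1 h2]
  congr 1; ext y; ring

theorem memLp_mul_bounded {φ : ℝ → ℂ} (hφ : MemLp φ 2 volume) {w : ℝ → ℝ} {M : ℝ}
    (hw : AEStronglyMeasurable w volume) (h0 : ∀ y, 0 ≤ w y) (hM : ∀ y, w y ≤ M) :
    MemLp (fun y => φ y * (w y : ℂ)) 2 volume := by
  refine (hφ.const_mul (M : ℂ)).of_le
    (hφ.1.mul (Complex.continuous_ofReal.comp_aestronglyMeasurable hw))
    (Eventually.of_forall fun y => ?_)
  rw [norm_mul, norm_mul, mul_comm, Complex.norm_real, Complex.norm_real,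
    Real.norm_of_nonneg (h0 y), Real.norm_of_nonneg ((h0 y).trans (hM y))]
  exact mul_le_mul_of_nonneg_right (hM y) (norm_nonneg _)

theorem HasSpectralDensity.inner_fullFiltered_curve (hx : HasSpectralDensity x f) {M : ℝ}
    (hM : ∀ y, f y ≤ M) {H : ℝ → ℝ} (hH : MemLp H 2 volume) (t s : ℝ) :
    ((inner ℝ (fullFiltered x H t) (x s) : ℝ) : ℂ)
      = ∫ y, chr (t - s) y * (plancherel H hH y * f y) := by
  rw [hx.inner_fullFiltered_eq hM hH (φ := fun y => chr (-s) y * f y)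
    (integrable_chr_mul hx.integrable.ofReal _)
    (memLp_chr_mul (memLp_two_of_bounded hx.integrable hx.nonneg hM).ofReal _)
    (fun q => by rw [hx.inner_eq]; simp_rw [sub_eq_add_neg, chr_add, mul_assoc]) t]
  simp_rw [sub_eq_add_neg, chr_add]
  congr 1; ext y; ring

theorem HasSpectralDensity.hasSpectralDensity_fullFiltered (hx : HasSpectralDensity x f) {M : ℝ}
    (hM : ∀ y, f y ≤ M) {H : ℝ → ℝ} (hH : MemLp H 2 volume) :
    HasSpectralDensity (fullFiltered x H) fun y => ‖plancherel H hH y‖ ^ 2 * f y := by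
  have hm := memLp_plancherel H hH
  have hm' : MemLp (fun y => (starRingEnd ℂ) (plancherel H hH y)) 2 volume := hm.star
  refine ⟨fun y => mul_nonneg (by positivity) (hx.nonneg y), ?_, fun t s => ?_⟩
  · refine (hm.integrable_norm_pow (by norm_num)).mul_bdd (c := M) hx.integrable.1
      (Eventually.of_forall fun y => ?_)
    rw [Real.norm_of_nonneg (hx.nonneg y)]; exact hM y
  · have e1 : ∀ r, ((inner ℝ (x r) (fullFiltered x H s) : ℝ) : ℂ)
        = ∫ y, chr r y * (chr (-s) y * ((starRingEnd ℂ) (plancherel H hH y) * f y)) := by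
      intro r
      rw [real_inner_comm, ofReal_eq_integral_conj (hx.inner_fullFiltered_curve hM hH s r)]
      refine integral_congr_ae (Eventually.of_forall fun y => ?_)
      simp only [map_mul, conj_chr, Complex.conj_ofReal]
      rw [neg_sub, sub_eq_add_neg, chr_add]
      ring
    rw [hx.inner_fullFiltered_eq hM hH
      (φ := fun y => chr (-s) y * ((starRingEnd ℂ) (plancherel H hH y) * (f y : ℂ)))
      (integrable_chr_mul (integrable_mul_of_memLp_two hm'
        (memLp_two_of_bounded hx.integrable hx.nonneg hM).ofReal) (-s))
      (memLp_chr_mul (memLp_mul_bounded hm' hx.integrable.1 hx.nonneg hM) (-s)) e1 t]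
    refine integral_congr_ae (Eventually.of_forall fun y => ?_)
    simp only
    push_cast
    rw [← Complex.mul_conj', sub_eq_add_neg, chr_add]
    ring

theorem HasSpectralDensity.inner_fullFiltered_eq_zero (hx : HasSpectralDensity x f) {M : ℝ}
    (hM : ∀ y, f y ≤ M) {H : ℝ → ℝ} (hH : MemLp H 2 volume) {z : E}
    (hz : ∀ r, inner ℝ (x r) z = 0) (t : ℝ) : inner ℝ (fullFiltered x H t) z = 0 := by
  have := hx.inner_fullFiltered_eq hM hH (z := z) (φ := fun _ => 0) (integrable_zero _ _ _)
    MemLp.zero (fun r => by simp [hz]) t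
  simpa using this

end Hilbert

/-! ### Mean-square limits as limits in `L²(P)` -/

theorem isMsLimit_of_tendsto {P : Measure Ω} {ι : Type*} {l : Filter ι} {S : ι → Ω → ℝ}
    {σ : ι → Lp ℝ 2 P} {ξ : Lp ℝ 2 P} (hS : ∀ᶠ i in l, S i =ᵐ[P] σ i)
    (h : Tendsto σ l (𝓝 ξ)) : IsMsLimit P l S ξ := by
  refine ⟨Lp.memLp ξ, ((Lp.tendsto_Lp_iff_tendsto_eLpNorm' _ _).1 h).congr' ?_⟩
  filter_upwards [hS] with i hi
  exact eLpNorm_congr_ae (hi.symm.sub EventuallyEq.rfl)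

theorem msConverges_of_tendsto {P : Measure Ω} {ι : Type*} {l : Filter ι} {S : ι → Ω → ℝ}
    {σ : ι → Lp ℝ 2 P} {ξ : Lp ℝ 2 P} (hS : ∀ᶠ i in l, S i =ᵐ[P] σ i)
    (h : Tendsto σ l (𝓝 ξ)) : MsConverges P l S :=
  ⟨ξ, isMsLimit_of_tendsto hS h⟩

theorem msLimit_ae_eq_of_tendsto {P : Measure Ω} {ι : Type*} {l : Filter ι} [l.NeBot]
    {S : ι → Ω → ℝ} {σ : ι → Lp ℝ 2 P} {ξ : Lp ℝ 2 P} (hS : ∀ᶠ i in l, S i =ᵐ[P] σ i)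
    (h : Tendsto σ l (𝓝 ξ)) : msLimit P l S =ᵐ[P] ξ := by
  have hc := msConverges_of_tendsto hS h
  rw [msLimit, dif_pos hc]
  obtain ⟨hm, ht⟩ := hc.choose_spec
  have h2 : Tendsto σ l (𝓝 (hm.toLp _)) := by
    refine (Lp.tendsto_Lp_iff_tendsto_eLpNorm _ _ _).2 (ht.congr' ?_)
    filter_upwards [hS] with i hi
    exact eLpNorm_congr_ae (hi.sub EventuallyEq.rfl)
  rw [tendsto_nhds_unique h h2]
  exact hm.coeFn_toLp.symm

/-! ### Riemann sums -/

theorem TaggedPartition.pt_mono {a b : ℝ} (π : TaggedPartition a b) {i j : ℕ} (hij : i ≤ j)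
    (hj : j ≤ π.n) : π.pt i ≤ π.pt j := by
  induction j, hij using Nat.le_induction with
  | base => exact le_rfl
  | succ k _ ih => exact (ih (by omega)).trans (π.pt_le k (by omega))

theorem TaggedPartition.pt_mem {a b : ℝ} (π : TaggedPartition a b) {i : ℕ} (hi : i ≤ π.n) :
    π.pt i ∈ Icc a b := by
  constructor
  · simpa [π.pt_zero] using π.pt_mono (Nat.zero_le i) hi
  · simpa [π.pt_last] using π.pt_mono hi le_rfl

theorem eventually_meshFilter {a b δ : ℝ} (hδ : 0 < δ) :
    ∀ᶠ π in meshFilter a b, ∀ i < π.n, π.pt (i + 1) - π.pt i < δ :=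
  mem_iInf_of_mem (⟨δ, hδ⟩ : {δ : ℝ // 0 < δ}) (mem_principal_self _)

/-- The partition of `[a, b]` into `n + 1` intervals of equal length. -/
def uniformPartition {a b : ℝ} (hab : a ≤ b) (n : ℕ) : TaggedPartition a b where
  n := n + 1
  pt i := a + i * ((b - a) / (n + 1))
  tag i := a + i * ((b - a) / (n + 1))
  pt_zero := by simp
  pt_last := by
    push_cast
    field_simp
    ring
  pt_le i _ := by
    have : 0 ≤ (b - a) / (n + 1) := div_nonneg (sub_nonneg.2 hab) (by positivity)
    push_cast
    nlinarith
  tag_mem i _ := by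
    have : 0 ≤ (b - a) / (n + 1) := div_nonneg (sub_nonneg.2 hab) (by positivity)
    refine ⟨le_rfl, ?_⟩
    push_cast
    nlinarith

/-- Uniqueness of mean-square limits, hence the identification of `msRiemannIntegral`, needs a
nontrivial filter; fine uniform partitions provide it. -/
theorem meshFilter_neBot {a b : ℝ} (hab : a ≤ b) : (meshFilter a b).NeBot := by
  refine iInf_neBot_of_directed' ?_ fun δ => ?_
  · intro δ₁ δ₂
    refine ⟨⟨min δ₁.1 δ₂.1, lt_min δ₁.2 δ₂.2⟩, ?_, ?_⟩
    · exact principal_mono.2 fun π hπ i hi => (hπ i hi).trans_le (min_le_left _ _)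
    · exact principal_mono.2 fun π hπ i hi => (hπ i hi).trans_le (min_le_right _ _)
  · rw [principal_neBot_iff]
    obtain ⟨n, hn⟩ := exists_nat_gt ((b - a) / δ.1)
    refine ⟨uniformPartition hab n, fun i _ => ?_⟩
    have h1 : (b - a) / (n + 1) < δ.1 := by
      rw [div_lt_iff₀ (by positivity)]
      rw [div_lt_iff₀ δ.2] at hn
      nlinarith [δ.2]
    simp only [uniformPartition]
    push_cast
    linarith

theorem tendsto_riemannSum {E : Type*} [NormedAddCommGroup E] [NormedSpace ℝ E] [CompleteSpace E]
    {ζ : ℝ → E} (hζ : Continuous ζ) {a b : ℝ} (hab : a ≤ b) :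
    Tendsto (fun π : TaggedPartition a b =>
      ∑ i ∈ Finset.range π.n, (π.pt (i + 1) - π.pt i) • ζ (π.tag i)) (meshFilter a b)
      (𝓝 (∫ t in a..b, ζ t)) := by
  rw [Metric.tendsto_nhds]
  intro ε hε
  have huc := isCompact_Icc.uniformContinuousOn_of_continuous (s := Icc a b) hζ.continuousOn
  -- The `+ 1` keeps the denominator positive when `a = b` and makes the final inequality strict.
  set η := ε / (b - a + 1) with hη
  have hη0 : 0 < η := div_pos hε (by linarith)
  obtain ⟨δ, hδ, hδ'⟩ := Metric.uniformContinuousOn_iff.1 huc η hη0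
  filter_upwards [eventually_meshFilter hδ] with π hπ
  have hint : ∀ i < π.n, IntervalIntegrable ζ volume (π.pt i) (π.pt (i + 1)) :=
    fun i _ => hζ.intervalIntegrable _ _
  have hsum := intervalIntegral.sum_integral_adjacent_intervals hint
  rw [π.pt_zero, π.pt_last] at hsum
  rw [dist_eq_norm, ← hsum, ← Finset.sum_sub_distrib]
  have hterm : ∀ i ∈ Finset.range π.n, ‖(π.pt (i + 1) - π.pt i) • ζ (π.tag i)
      - ∫ t in π.pt i..π.pt (i + 1), ζ t‖ ≤ η * (π.pt (i + 1) - π.pt i) := by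
    intro i hi
    have hin := Finset.mem_range.1 hi
    have hle := π.pt_le i hin
    have ht := π.tag_mem i hin
    have hi1 := π.pt_mem hin.le
    have hi2 := π.pt_mem (Nat.succ_le_of_lt hin)
    rw [← intervalIntegral.integral_const, ← intervalIntegral.integral_sub (by simp)
      (hint i hin)]
    refine (intervalIntegral.norm_integral_le_of_norm_le_const (C := η) fun t htt => ?_).trans
      (le_of_eq ?_)
    · rw [uIoc_of_le hle] at htt
      rw [← dist_eq_norm]
      refine (hδ' _ ⟨hi1.1.trans ht.1, ht.2.trans hi2.2⟩ _
        ⟨hi1.1.trans htt.1.le, htt.2.trans hi2.2⟩ ?_).le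
      rw [Real.dist_eq, abs_lt]
      have := hπ i hin
      constructor <;> linarith [ht.1, ht.2, htt.1, htt.2]
    · rw [abs_of_nonneg (sub_nonneg.2 hle)]
  calc _ ≤ ∑ i ∈ Finset.range π.n, η * (π.pt (i + 1) - π.pt i) := norm_sum_le_of_le _ hterm
    _ = η * (b - a) := by rw [← Finset.mul_sum, Finset.sum_range_sub, π.pt_zero, π.pt_last]
    _ < η * (b - a + 1) := by nlinarith
    _ = ε := by rw [hη]; exact div_mul_cancel₀ _ (by linarith)

theorem riemannSum_ae_eq {P : Measure Ω} {ξ : ℝ → Ω → ℝ} {ζ : ℝ → Lp ℝ 2 P}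
    (h : ∀ t, ξ t =ᵐ[P] ζ t) {a b : ℝ} (π : TaggedPartition a b) :
    riemannSum ξ π
      =ᵐ[P] (∑ i ∈ Finset.range π.n, (π.pt (i + 1) - π.pt i) • ζ (π.tag i) : Lp ℝ 2 P) := by
  refine EventuallyEq.trans ?_ (Lp.coeFn_finsetSum _ _).symm
  have e : riemannSum ξ π
      = ∑ i ∈ Finset.range π.n, (π.pt (i + 1) - π.pt i) • ξ (π.tag i) := by
    ext ω; simp [riemannSum]
  rw [e]
  refine eventuallyEq_sum fun i _ => ?_
  filter_upwards [Lp.coeFn_smul (π.pt (i + 1) - π.pt i) (ζ (π.tag i)), h (π.tag i)] with ω h1 h2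
  rw [h1, Pi.smul_apply, Pi.smul_apply, h2]

theorem msConverges_riemannSum {P : Measure Ω} {ξ : ℝ → Ω → ℝ} {ζ : ℝ → Lp ℝ 2 P}
    (h : ∀ t, ξ t =ᵐ[P] ζ t) (hζ : Continuous ζ) {a b : ℝ} (hab : a ≤ b) :
    MsConverges P (meshFilter a b) (riemannSum ξ) :=
  msConverges_of_tendsto (Eventually.of_forall fun π => riemannSum_ae_eq h π)
    (tendsto_riemannSum hζ hab)

theorem msRiemannIntegral_ae_eq {P : Measure Ω} {ξ : ℝ → Ω → ℝ} {ζ : ℝ → Lp ℝ 2 P}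
    (h : ∀ t, ξ t =ᵐ[P] ζ t) (hζ : Continuous ζ) {a b : ℝ} (hab : a ≤ b) :
    msRiemannIntegral P ξ a b =ᵐ[P] (∫ t in a..b, ζ t : Lp ℝ 2 P) := by
  have := meshFilter_neBot hab
  exact msLimit_ae_eq_of_tendsto (Eventually.of_forall fun π => riemannSum_ae_eq h π)
    (tendsto_riemannSum hζ hab)

/-! ### The response as an element of `L²(P)` -/

section Response

variable {P : Measure Ω} {X : ℝ → Ω → ℝ} {f : ℝ → ℝ}

theorem IsStationaryGaussian.memLp (hX : IsStationaryGaussian P X f) (t : ℝ) :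
    MemLp (X t) 2 P := (hX.gaussian.hasGaussianLaw_eval t).memLp_two

/-- The process as a curve in `L²(P)`. -/
def IsStationaryGaussian.curve (hX : IsStationaryGaussian P X f) (t : ℝ) : Lp ℝ 2 P :=
  (hX.memLp t).toLp (X t)

theorem IsStationaryGaussian.curve_ae_eq (hX : IsStationaryGaussian P X f) (t : ℝ) :
    hX.curve t =ᵐ[P] X t := (hX.memLp t).coeFn_toLp

theorem IsStationaryGaussian.hasSpectralDensity (hX : IsStationaryGaussian P X f) :
    HasSpectralDensity hX.curve f := by
  refine ⟨hX.density_nonneg, hX.density_integrable, fun s t => ?_⟩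
  have h := hX.covariance t (s - t)
  rw [add_sub_cancel] at h
  rw [IsStationaryGaussian.curve, IsStationaryGaussian.curve, real_inner_toLp, h]
  rfl

variable [IsProbabilityMeasure P]

theorem IsStationaryGaussian.integrable_prod (hX : IsStationaryGaussian P X f) {h : ℝ → ℝ}
    (hh : Integrable h) (t : ℝ) :
    Integrable (fun q : ℝ × Ω => h q.1 * X (t - q.1) q.2) (volume.prod P) := by
  have hm : Measurable fun q : ℝ × Ω => X (t - q.1) q.2 :=
    hX.measurable.comp ((measurable_const.sub measurable_fst).prodMk measurable_snd)
  have hm' : AEStronglyMeasurable (fun q : ℝ × Ω => h q.1 * X (t - q.1) q.2) (volume.prod P) :=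
    hh.1.comp_fst.mul hm.aestronglyMeasurable
  refine (integrable_prod_iff hm').2 ⟨Eventually.of_forall fun s => ?_, ?_⟩
  · exact ((hX.memLp (t - s)).integrable (by norm_num)).const_mul (h s)
  · refine (hh.norm.mul_const ‖hX.curve 0‖).mono' hm'.norm.integral_prod_right'
      (Eventually.of_forall fun s => ?_)
    rw [Real.norm_of_nonneg (integral_nonneg fun _ => norm_nonneg _)]
    simp only [norm_mul]
    rw [integral_const_mul]
    gcongr
    have hd := (hX.memLp (t - s)).integrable (by norm_num)
    rw [← hX.hasSpectralDensity.norm_eq (t - s), IsStationaryGaussian.curve, Lp.norm_toLp,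
      integral_norm_eq_lintegral_enorm hd.1, ← eLpNorm_one_eq_lintegral_enorm]
    exact ENNReal.toReal_mono (hX.memLp _).2.ne
      (eLpNorm_le_eLpNorm_of_exponent_le (by norm_num) hd.1)

/-- The pathwise integral and the `L²(P)`-valued Bochner integral have the same integral over every
event: Fubini for the first, pairing with an indicator for the second. Joint measurability of the
process enters through `integrable_prod`. -/
theorem IsStationaryGaussian.integral_ae_eq_filtered (hX : IsStationaryGaussian P X f)
    {h : ℝ → ℝ} (hh : Integrable h) (t : ℝ) :
    (fun ω => ∫ s, h s * X (t - s) ω) =ᵐ[P] (filtered hX.curve h t : Lp ℝ 2 P) := by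
  have hi := hX.integrable_prod hh t
  refine Integrable.ae_eq_of_forall_setIntegral_eq _ _ hi.integral_prod_right
    ((Lp.memLp _).integrable (by norm_num)) fun A hA hAf => ?_
  have hi' : Integrable (fun q : ℝ × Ω => h q.1 * X (t - q.1) q.2)
      (volume.prod (P.restrict A)) := by
    refine hi.mono_measure ?_
    exact Measure.prod_mono le_rfl Measure.restrict_le_self
  rw [← integral_integral_swap hi', ← L2.inner_indicatorConstLp_one (𝕜 := ℝ) hA hAf.ne,
    real_inner_comm, hX.hasSpectralDensity.inner_filtered hh]
  refine integral_congr_ae (Eventually.of_forall fun s => ?_)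
  simp only
  rw [integral_const_mul, real_inner_comm, L2.inner_indicatorConstLp_one]
  congr 1
  exact integral_congr_ae (ae_restrict_of_ae (hX.curve_ae_eq (t - s)).symm)

/-- The order `p.1 ≤ p.2` matters: for reversed endpoints the interval integral changes sign,
whereas the window is empty. -/
theorem IsStationaryGaussian.truncatedResponse_ae_eq (hX : IsStationaryGaussian P X f)
    {H : ℝ → ℝ} (hH : MemLp H 2 volume) (t : ℝ) {p : ℝ × ℝ} (hp : p.1 ≤ p.2) :
    truncatedResponse H X t p =ᵐ[P] (filtered hX.curve (window H p) t : Lp ℝ 2 P) := by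
  refine EventuallyEq.trans (Eventually.of_forall fun ω => ?_)
    (hX.integral_ae_eq_filtered (integrable_window hH p) t)
  simp only [truncatedResponse]
  rw [intervalIntegral.integral_of_le hp, ← integral_indicator measurableSet_Ioc]
  refine integral_congr_ae (Eventually.of_forall fun s => ?_)
  by_cases hs : s ∈ Ioc p.1 p.2 <;> simp [window, hs]

theorem eventually_fst_le_snd : ∀ᶠ p : ℝ × ℝ in atBot ×ˢ atTop, p.1 ≤ p.2 := by
  have h1 : ∀ᶠ p : ℝ × ℝ in atBot ×ˢ atTop, p.1 ≤ 0 :=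
    tendsto_fst.eventually (eventually_le_atBot 0)
  have h2 : ∀ᶠ p : ℝ × ℝ in atBot ×ˢ atTop, 0 ≤ p.2 :=
    tendsto_snd.eventually (eventually_ge_atTop 0)
  filter_upwards [h1, h2] with p h1 h2 using h1.trans h2

theorem IsStationaryGaussian.msConverges_truncatedResponse (hX : IsStationaryGaussian P X f)
    {M : ℝ} (hM : ∀ y, f y ≤ M) {H : ℝ → ℝ} (hH : MemLp H 2 volume) (t : ℝ) :
    MsConverges P (atBot ×ˢ atTop) (truncatedResponse H X t) :=
  msConverges_of_tendsto
    (eventually_fst_le_snd.mono fun _ hp => hX.truncatedResponse_ae_eq hH t hp)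
    (hX.hasSpectralDensity.tendsto_filtered hM hH t)

theorem IsStationaryGaussian.response_ae_eq (hX : IsStationaryGaussian P X f)
    {M : ℝ} (hM : ∀ y, f y ≤ M) {H : ℝ → ℝ} (hH : MemLp H 2 volume) {U : ℝ → Ω → ℝ} {g : ℝ → ℝ}
    (hU : IsStationaryGaussian P U g) (t : ℝ) :
    response P H X U t =ᵐ[P] (fullFiltered hX.curve H t + hU.curve t : Lp ℝ 2 P) := by
  have h := msLimit_ae_eq_of_tendsto
    (eventually_fst_le_snd.mono fun _ hp => hX.truncatedResponse_ae_eq hH t hp)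
    (hX.hasSpectralDensity.tendsto_filtered hM hH t)
  filter_upwards [h, hU.curve_ae_eq t, Lp.coeFn_add (fullFiltered hX.curve H t) (hU.curve t)]
    with ω h1 h2 h3
  rw [response, h3, Pi.add_apply, h1, h2]

end Response

/-- A vector orthogonal to the whole curve has zero cross-spectrum with it, so it is orthogonal to
the filtered curve; a closed subspace equals its double orthogonal complement. -/
theorem HasSpectralDensity.fullFiltered_mem {E : Type*} [NormedAddCommGroup E]
    [InnerProductSpace ℝ E] [CompleteSpace E] {x : ℝ → E} {f : ℝ → ℝ}
    (hx : HasSpectralDensity x f) {M : ℝ}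
    (hM : ∀ y, f y ≤ M) {H : ℝ → ℝ} (hH : MemLp H 2 volume) {G : Submodule ℝ E}
    (hG : IsClosed (G : Set E)) (hxG : ∀ t, x t ∈ G) (t : ℝ) : fullFiltered x H t ∈ G := by
  have : CompleteSpace G := hG.completeSpace_coe
  rw [← G.orthogonal_orthogonal, Submodule.mem_orthogonal']
  intro z hz
  refine hx.inner_fullFiltered_eq_zero hM hH (fun r => ?_) t
  exact Submodule.inner_right_of_mem_orthogonal (hxG r) hz

/-! ### The Fejér kernel -/

/-- The Fejér kernel `|∫₀¹ e^{-i w s} ds|²`. -/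
def fejer (w : ℝ) : ℝ := ‖angularFourier ((Ioc (0 : ℝ) 1).indicator 1) w‖ ^ 2

theorem integrable_indicator_unit : Integrable ((Ioc (0 : ℝ) 1).indicator (1 : ℝ → ℝ)) :=
  (integrable_indicator_iff measurableSet_Ioc).2 (integrableOn_const (by simp))

theorem memLp_indicator_unit : MemLp ((Ioc (0 : ℝ) 1).indicator (1 : ℝ → ℝ)) 2 volume :=
  memLp_indicator_const 2 measurableSet_Ioc 1 (by simp)

theorem fejer_nonneg (w : ℝ) : 0 ≤ fejer w := by unfold fejer; positivity

theorem continuous_fejer : Continuous fejer :=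
  (continuous_angularFourier integrable_indicator_unit).norm.pow 2

theorem fejer_le_one (w : ℝ) : fejer w ≤ 1 := by
  have h := norm_angularFourier_le ((Ioc (0 : ℝ) 1).indicator 1) w
  have e : ∫ s, |(Ioc (0 : ℝ) 1).indicator (1 : ℝ → ℝ) s| = 1 := by
    have : (fun s => |(Ioc (0 : ℝ) 1).indicator (1 : ℝ → ℝ) s|)
        = (Ioc (0 : ℝ) 1).indicator (1 : ℝ → ℝ) := by
      ext s; by_cases hs : s ∈ Ioc (0 : ℝ) 1 <;> simp [hs]
    rw [this, integral_indicator_one measurableSet_Ioc]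
    simp
  rw [e] at h
  exact pow_le_one₀ (norm_nonneg _) h

theorem integrable_fejer : Integrable fejer :=
  (memLp_angularFourier integrable_indicator_unit memLp_indicator_unit).integrable_norm_pow
    (by norm_num)

theorem integral_fejer : ∫ w, fejer w = 2 * Real.pi := by
  unfold fejer
  rw [integral_norm_sq_angularFourier integrable_indicator_unit memLp_indicator_unit]
  have : (fun s => (Ioc (0 : ℝ) 1).indicator (1 : ℝ → ℝ) s ^ 2)
      = (Ioc (0 : ℝ) 1).indicator (1 : ℝ → ℝ) := by
    ext s; by_cases hs : s ∈ Ioc (0 : ℝ) 1 <;> simp [hs]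
  rw [this, integral_indicator_one measurableSet_Ioc]
  simp

theorem norm_ofReal_fejer_le (w : ℝ) : ‖(fejer w : ℂ)‖ ≤ 1 := by
  rw [Complex.norm_real, Real.norm_of_nonneg (fejer_nonneg w)]; exact fejer_le_one w

theorem integral_chr_neg {T : ℝ} (hT : 0 < T) (y : ℝ) :
    ∫ s in Ioc 0 T, chr (-s) y = T * angularFourier ((Ioc (0 : ℝ) 1).indicator 1) (T * y) := by
  rw [← intervalIntegral.integral_of_le hT.le]
  have h := intervalIntegral.smul_integral_comp_mul_left (a := 0) (b := 1)
    (fun s => chr (-s) y) T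
  rw [mul_zero, mul_one] at h
  rw [← h, angularFourier_eq_integral_chr, intervalIntegral.integral_of_le zero_le_one,
    ← integral_indicator measurableSet_Ioc, Complex.real_smul]
  congr 1
  refine integral_congr_ae (Eventually.of_forall fun s => ?_)
  by_cases hs : s ∈ Ioc (0 : ℝ) 1
  · simp only [hs, indicator_of_mem, Pi.one_apply, Complex.ofReal_one, mul_one]
    unfold chr; congr 1; push_cast; ring
  · simp [hs]

/-- The integrand factors over the square, so the integral is `|∫₀ᵀ e^{-i s y} ds|²`, which rescales
to the Fejér kernel. -/
theorem integral_chr_sub {T : ℝ} (hT : 0 < T) (y : ℝ) :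
    ∫ r : ℝ × ℝ, chr (r.1 - r.2) y ∂((volume.restrict (Ioc 0 T)).prod (volume.restrict (Ioc 0 T)))
      = T ^ 2 * fejer (T * y) := by
  simp_rw [sub_eq_add_neg, chr_add]
  rw [integral_prod_mul (fun t => chr t y) (fun s => chr (-s) y), integral_chr_neg hT]
  have h : ∫ t in Ioc 0 T, chr t y
      = (starRingEnd ℂ) (T * angularFourier ((Ioc (0 : ℝ) 1).indicator 1) (T * y)) := by
    rw [← integral_chr_neg hT, ← integral_conj]
    simp_rw [conj_chr, neg_neg]
  rw [h, map_mul, Complex.conj_ofReal, fejer]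
  push_cast
  rw [← Complex.conj_mul']
  ring

/-- The smoothing of `b` by the Fejér kernel at scale `1 / T`. -/
def fejerMean (b : ℝ → ℂ) (T y : ℝ) : ℂ := ∫ w, fejer w * b (y - w / T)

theorem integral_mul_fejer {T : ℝ} (hT : 0 < T) (b : ℝ → ℂ) :
    ∫ v, (fejer (T * v) : ℂ) * b v = (T : ℂ)⁻¹ * ∫ w, (fejer w : ℂ) * b (w / T) := by
  have h := Measure.integral_comp_mul_left (fun w => (fejer w : ℂ) * b (w / T)) T
  simp only [mul_div_cancel_left₀ _ hT.ne'] at h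
  rw [h, abs_of_pos (inv_pos.2 hT), Complex.real_smul]
  push_cast
  rfl

theorem integral_fejer_convolution {T : ℝ} (hT : 0 < T) (b : ℝ → ℂ) (y : ℝ) :
    ∫ z, (fejer (T * (y - z)) : ℂ) * b z = (T : ℂ)⁻¹ * fejerMean b T y := by
  rw [fejerMean, ← integral_mul_fejer hT (fun v => b (y - v)),
    ← integral_sub_left_eq_self (fun z => (fejer (T * (y - z)) : ℂ) * b z) volume y]
  simp

theorem integrable_fejer_mul_prod {a b : ℝ → ℂ} (ha : Integrable a) (hb : Integrable b) (T : ℝ) :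
    Integrable (fun q : ℝ × ℝ => (fejer (T * (q.1 - q.2)) : ℂ) * (a q.1 * b q.2))
      (volume.prod volume) := by
  refine (ha.mul_prod hb).bdd_mul (c := 1) ?_
    (Eventually.of_forall fun q => norm_ofReal_fejer_le _)
  have := continuous_fejer
  exact (by fun_prop : Continuous fun q : ℝ × ℝ =>
    (fejer (T * (q.1 - q.2)) : ℂ)).aestronglyMeasurable

theorem aestronglyMeasurable_fejerMean {T : ℝ} (hT : 0 < T) {b : ℝ → ℂ} (hb : Integrable b) :
    AEStronglyMeasurable (fejerMean b T) volume := by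
  have e : fejerMean b T = fun y => (T : ℂ) * ∫ z, (fejer (T * (y - z)) : ℂ) * b z := by
    ext y
    rw [integral_fejer_convolution hT, mul_inv_cancel_left₀ (by exact_mod_cast hT.ne')]
  rw [e]
  refine AEStronglyMeasurable.const_mul ?_ _
  have := continuous_fejer
  have hm : AEStronglyMeasurable (fun q : ℝ × ℝ => (fejer (T * (q.1 - q.2)) : ℂ) * b q.2)
      (volume.prod volume) :=
    (by fun_prop : Continuous fun q : ℝ × ℝ =>
      (fejer (T * (q.1 - q.2)) : ℂ)).aestronglyMeasurable.mul hb.1.comp_snd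
  exact hm.integral_prod_right'

/-- The time average over a square of a product of two Fourier transforms. -/
theorem integral_integral_chr_mul_chr {a b : ℝ → ℂ} (ha : Integrable a) (hb : Integrable b)
    {T : ℝ} (hT : 0 < T) :
    ∫ t in 0..T, ∫ s in 0..T, (∫ y, chr (t - s) y * a y) * (∫ z, chr (-(t - s)) z * b z)
      = T * ∫ y, a y * fejerMean b T y := by
  set μ := volume.restrict (Ioc 0 T) with hμ
  -- Characters have modulus one and the time square has finite measure, so Fubini may exchange the
  -- two times with the two frequencies.
  have hbig : Integrable (fun p : (ℝ × ℝ) × (ℝ × ℝ) =>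
      chr (p.1.1 - p.1.2) (p.2.1 - p.2.2) * (a p.2.1 * b p.2.2))
      ((μ.prod μ).prod (volume.prod volume)) := by
    refine ((ha.mul_prod hb).comp_snd (μ.prod μ)).bdd_mul (c := 1) ?_
      (Eventually.of_forall fun p => (norm_chr _ _).le)
    exact (Continuous.chr (by fun_prop) (by fun_prop)).aestronglyMeasurable
  have hprod : ∀ u : ℝ, (∫ y, chr u y * a y) * (∫ z, chr (-u) z * b z)
      = ∫ q : ℝ × ℝ, chr u (q.1 - q.2) * (a q.1 * b q.2) ∂(volume.prod volume) := by
    intro u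
    rw [← integral_prod_mul]
    refine integral_congr_ae (Eventually.of_forall fun q => ?_)
    have : chr u (q.1 - q.2) = chr u q.1 * chr (-u) q.2 := by
      unfold chr; rw [← Complex.exp_add]; congr 1; push_cast; ring
    simp only
    rw [this]; ring
  simp_rw [hprod, intervalIntegral.integral_of_le hT.le]
  have h1 := hbig.integral_prod_left
  rw [← integral_prod (fun r : ℝ × ℝ => ∫ q : ℝ × ℝ, chr (r.1 - r.2) (q.1 - q.2) *
    (a q.1 * b q.2) ∂(volume.prod volume)) h1]
  rw [integral_integral_swap hbig]
  simp_rw [integral_mul_const, hμ, integral_chr_sub hT, mul_assoc, integral_const_mul]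
  rw [integral_prod _ (integrable_fejer_mul_prod ha hb T), sq, mul_assoc]
  congr 1
  rw [← integral_const_mul]
  refine integral_congr_ae (Eventually.of_forall fun y => ?_)
  simp only
  calc (T : ℂ) * ∫ z, (fejer (T * (y - z)) : ℂ) * (a y * b z)
      = T * (a y * ∫ z, (fejer (T * (y - z)) : ℂ) * b z) := by
        rw [← integral_const_mul (a y)]; congr 2; ext z; ring
    _ = a y * fejerMean b T y := by
        rw [integral_fejer_convolution hT]
        have : (T : ℂ) ≠ 0 := by exact_mod_cast hT.ne'
        field_simp

theorem integrable_mul_translate {a b : ℝ → ℂ} (ha : Integrable a) (hb : Integrable b) :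
    Integrable (fun q : ℝ × ℝ => a q.2 * b (q.2 - q.1)) (volume.prod volume) := by
  have := Integrable.convolution_integrand (ContinuousLinearMap.mul ℝ ℂ) ha hb.comp_neg
    (μ := volume) (ν := volume)
  simpa using this

theorem integrable_fejer_mul_correlation {a b : ℝ → ℂ} (ha : Integrable a) (hb : Integrable b)
    {T : ℝ} (hT : 0 < T) :
    Integrable fun w => (fejer w : ℂ) * ∫ y, a y * b (y - w / T) := by
  have h := (integrable_mul_translate ha hb).integral_prod_left
  have h2 := h.bdd_mul (c := 1) (f := fun v => (fejer (T * v) : ℂ))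
    (by
      have := continuous_fejer
      exact (by fun_prop : Continuous fun v => (fejer (T * v) : ℂ)).aestronglyMeasurable)
    (Eventually.of_forall fun q => norm_ofReal_fejer_le _)
  have h3 := h2.comp_div hT.ne'
  refine h3.congr (Eventually.of_forall fun w => ?_)
  simp only
  rw [mul_div_cancel₀ _ hT.ne']

/-- Moves the kernel from `b` to the lag of the correlation of `a` and `b`, so that no pointwise
control of the Fejér mean of `b` is required. -/
theorem integral_mul_fejerMean {a b : ℝ → ℂ} (ha : Integrable a) (hb : Integrable b)
    {T : ℝ} (hT : 0 < T) :
    ∫ y, a y * fejerMean b T y = ∫ w, (fejer w : ℂ) * ∫ y, a y * b (y - w / T) := by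
  have hT' : (T : ℂ) ≠ 0 := by exact_mod_cast hT.ne'
  have e1 : ∀ y, a y * fejerMean b T y
      = T * ∫ v, (fejer (T * v) : ℂ) * (a y * b (y - v)) := by
    intro y
    rw [fejerMean, ← mul_inv_cancel_left₀ hT' (∫ w, (fejer w : ℂ) * b (y - w / T)),
      ← integral_mul_fejer hT (fun v => b (y - v)), ← mul_assoc, mul_comm (a y), mul_assoc,
      ← integral_const_mul]
    congr 2; ext v; ring
  have e2 : ∫ w, (fejer w : ℂ) * ∫ y, a y * b (y - w / T)
      = T * ∫ v, ∫ y, (fejer (T * v) : ℂ) * (a y * b (y - v)) := by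
    simp_rw [integral_const_mul]
    rw [integral_mul_fejer hT (fun v => ∫ y, a y * b (y - v)), mul_inv_cancel_left₀ hT']
  simp_rw [e1]
  rw [e2, integral_const_mul]
  congr 1
  rw [integral_integral_swap]
  have := continuous_fejer
  refine ((integrable_mul_translate ha hb).bdd_mul (c := 1)
    (f := fun q : ℝ × ℝ => (fejer (T * q.1) : ℂ))
    (by fun_prop : Continuous fun q : ℝ × ℝ => (fejer (T * q.1) : ℂ)).aestronglyMeasurable
    (Eventually.of_forall fun q => norm_ofReal_fejer_le _)).swap

/-! ### Limits -/

section Limits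

variable {ι : Type*} {l : Filter ι} {T : ι → ℝ}

theorem tendsto_div_of_tendsto_atTop (hTl : Tendsto T l atTop) (w : ℝ) :
    Tendsto (fun i => w / T i) l (𝓝 0) := hTl.const_div_atTop w

/-- The evaluation point `y - w / T` moves with the index, so pointwise convergence of `b` would not
suffice; eventually it stays in a fixed compact interval, where convergence is uniform. The factor
`2π` is the mass of the kernel. -/
theorem tendsto_fejerMean [l.IsCountablyGenerated] (hTl : Tendsto T l atTop)
    {b : ι → ℝ → ℂ} {M : ℝ} {c : ℂ}
    (hb : ∀ i, Integrable (b i)) (hT : ∀ i, 0 < T i) (hbM : ∀ i y, ‖b i y‖ ≤ M)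
    (hbl : ∀ R > 0, TendstoUniformlyOn b (fun _ => c) l (Icc (-R) R)) (y : ℝ) :
    Tendsto (fun i => fejerMean (b i) (T i) y) l (𝓝 (2 * Real.pi * c)) := by
  have e : (2 * Real.pi * c : ℂ) = ∫ w, (fejer w : ℂ) * c := by
    rw [integral_mul_const, integral_complex_ofReal, integral_fejer]; push_cast; rfl
  rw [e]
  refine tendsto_integral_filter_of_dominated_convergence (fun w => fejer w * M) ?_ ?_
    (integrable_fejer.mul_const M) ?_
  · refine Eventually.of_forall fun i => ?_
    have h1 : Integrable fun w => b i (y - w / T i) := by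
      have := ((hb i).comp_sub_left y).comp_div (hT i).ne'
      exact this
    exact (Complex.continuous_ofReal.comp continuous_fejer).aestronglyMeasurable.mul h1.1
  · refine Eventually.of_forall fun i => Eventually.of_forall fun w => ?_
    rw [norm_mul, Complex.norm_real, Real.norm_of_nonneg (fejer_nonneg w)]
    exact mul_le_mul_of_nonneg_left (hbM i _) (fejer_nonneg w)
  · refine Eventually.of_forall fun w => Tendsto.const_mul _ ?_
    rw [Metric.tendsto_nhds]
    intro ε hε
    have hu := Metric.tendstoUniformlyOn_iff.1 (hbl (|y| + 1) (by positivity)) ε hε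
    have hd := Metric.tendsto_nhds.1 (tendsto_div_of_tendsto_atTop hTl w) 1 one_pos
    filter_upwards [hu, hd] with i h1 h2
    rw [dist_comm]
    apply h1
    rw [Real.dist_eq, sub_zero, abs_lt] at h2
    constructor <;> linarith [neg_abs_le y, le_abs_self y, h2.1, h2.2]

theorem norm_fejerMean_le {b : ℝ → ℂ} {M : ℝ} (hbM : ∀ y, ‖b y‖ ≤ M) (T y : ℝ) :
    ‖fejerMean b T y‖ ≤ 2 * Real.pi * M := by
  rw [← integral_fejer, ← integral_mul_const]
  refine norm_integral_le_of_norm_le (integrable_fejer.mul_const M)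
    (Eventually.of_forall fun w => ?_)
  rw [norm_mul, Complex.norm_real, Real.norm_of_nonneg (fejer_nonneg w)]
  exact mul_le_mul_of_nonneg_left (hbM _) (fejer_nonneg w)

theorem tendsto_integral_mul_fejerMean [l.IsCountablyGenerated] (hTl : Tendsto T l atTop)
    (hT : ∀ i, 0 < T i)
    {a b : ι → ℝ → ℂ} {a₀ : ℝ → ℂ} {A : ℝ → ℝ} {M : ℝ} {c : ℂ}
    (ha : ∀ i, AEStronglyMeasurable (a i) volume) (haA : ∀ i y, ‖a i y‖ ≤ A y)
    (hA : Integrable A) (hal : ∀ y, Tendsto (fun i => a i y) l (𝓝 (a₀ y)))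
    (hb : ∀ i, Integrable (b i)) (hbM : ∀ i y, ‖b i y‖ ≤ M)
    (hbl : ∀ R > 0, TendstoUniformlyOn b (fun _ => c) l (Icc (-R) R)) :
    Tendsto (fun i => ∫ y, a i y * fejerMean (b i) (T i) y) l
      (𝓝 (∫ y, a₀ y * (2 * Real.pi * c))) := by
  refine tendsto_integral_filter_of_dominated_convergence (fun y => A y * (2 * Real.pi * M)) ?_ ?_
    (hA.mul_const _) ?_
  · exact Eventually.of_forall fun i => (ha i).mul (aestronglyMeasurable_fejerMean (hT i) (hb i))
  · refine Eventually.of_forall fun i => Eventually.of_forall fun y => ?_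
    rw [norm_mul]
    exact mul_le_mul (haA i y) (norm_fejerMean_le (hbM i) _ _) (norm_nonneg _)
      ((norm_nonneg _).trans (haA i y))
  · exact Eventually.of_forall fun y => (hal y).mul (tendsto_fejerMean hTl hb hT hbM hbl y)

theorem memLp_translate {b : ℝ → ℂ} (hb : MemLp b 2 volume) (v : ℝ) :
    MemLp (fun y => b (y - v)) 2 volume :=
  hb.comp_measurePreserving (measurePreserving_sub_right volume v)

theorem norm_integral_mul_le {a b : ℝ → ℂ} (ha : MemLp a 2 volume) (hb : MemLp b 2 volume) :
    ‖∫ y, a y * b y‖ ≤ (∫ y, ‖a y‖ ^ 2) + ∫ y, ‖b y‖ ^ 2 := by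
  have h1 : Integrable fun y => ‖a y‖ ^ 2 := ha.integrable_norm_pow (by norm_num)
  have h2 : Integrable fun y => ‖b y‖ ^ 2 := hb.integrable_norm_pow (by norm_num)
  rw [← integral_add h1 h2]
  refine norm_integral_le_of_norm_le (h1.add h2) (Eventually.of_forall fun y => ?_)
  rw [norm_mul]
  nlinarith [sq_nonneg (‖a y‖ - ‖b y‖), norm_nonneg (a y), norm_nonneg (b y),
    mul_nonneg (norm_nonneg (a y)) (norm_nonneg (b y))]

theorem tendsto_integral_mul_translate {v : ι → ℝ} (hv : Tendsto v l (𝓝 0))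
    {a b : ι → ℝ → ℂ} {a₀ b₀ : ℝ → ℂ}
    (ha : ∀ i, MemLp (a i) 2 volume) (hb : ∀ i, MemLp (b i) 2 volume)
    (ha₀ : MemLp a₀ 2 volume) (hb₀ : MemLp b₀ 2 volume)
    (hat : Tendsto (fun i => eLpNorm (a i - a₀) 2 volume) l (𝓝 0))
    (hbt : Tendsto (fun i => eLpNorm (b i - b₀) 2 volume) l (𝓝 0)) :
    Tendsto (fun i => ∫ y, a i y * b i (y - v i)) l (𝓝 (∫ y, a₀ y * b₀ y)) := by
  refine tendsto_integral_mul_of_tendsto_eLpNorm ha (fun i => memLp_translate (hb i) (v i))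
    ha₀ hb₀ hat ?_
  have h1 := (tendsto_eLpNorm_translate_sub hb₀).comp hv
  have h2 := hbt.add h1
  rw [add_zero] at h2
  refine tendsto_of_tendsto_of_tendsto_of_le_of_le tendsto_const_nhds h2 (fun _ => zero_le) ?_
  intro i
  -- The first part has the norm of `b i - b₀`, by translation invariance; the second is small by
  -- continuity of translations.
  have e : (fun y => b i (y - v i)) - b₀
      = (fun y => (b i - b₀) (y - v i)) + fun y => b₀ (y - v i) - b₀ y := by
    ext y; simp
  simp only [Function.comp]
  rw [e]
  refine (eLpNorm_add_le (memLp_translate ((hb i).sub hb₀) _).1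
    ((memLp_translate hb₀ _).sub hb₀).1 (by norm_num)).trans (le_of_eq ?_)
  congr 1
  exact eLpNorm_comp_measurePreserving ((hb i).sub hb₀).1
    (measurePreserving_sub_right volume (v i))

theorem tendsto_integral_fejer_mul_correlation [l.IsCountablyGenerated] (hTl : Tendsto T l atTop)
    (hT : ∀ i, 0 < T i)
    {a b : ι → ℝ → ℂ} {a₀ b₀ : ℝ → ℂ} {A : ℝ → ℝ} (hA : MemLp A 2 volume)
    (ha : ∀ i, Integrable (a i)) (hb : ∀ i, Integrable (b i))
    (ha₀ : MemLp a₀ 2 volume) (hb₀ : MemLp b₀ 2 volume)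
    (haA : ∀ i y, ‖a i y‖ ≤ A y) (hbA : ∀ i y, ‖b i y‖ ≤ A y)
    (haA₀ : ∀ y, ‖a₀ y‖ ≤ A y) (hbA₀ : ∀ y, ‖b₀ y‖ ≤ A y)
    (hal : ∀ y, Tendsto (fun i => a i y) l (𝓝 (a₀ y)))
    (hbl : ∀ y, Tendsto (fun i => b i y) l (𝓝 (b₀ y))) :
    Tendsto (fun i => ∫ y, a i y * fejerMean (b i) (T i) y) l
      (𝓝 (2 * Real.pi * ∫ y, a₀ y * b₀ y)) := by
  have hA0 : ∀ y, 0 ≤ A y := fun y => (norm_nonneg _).trans (haA₀ y)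
  have ha2 : ∀ i, MemLp (a i) 2 volume := fun i => hA.of_le (ha i).1
    (Eventually.of_forall fun y => (haA i y).trans (le_abs_self _))
  have hb2 : ∀ i, MemLp (b i) 2 volume := fun i => hA.of_le (hb i).1
    (Eventually.of_forall fun y => (hbA i y).trans (le_abs_self _))
  have conv : ∀ {u : ι → ℝ → ℂ} {u₀ : ℝ → ℂ}, (∀ i, MemLp (u i) 2 volume) → MemLp u₀ 2 volume →
      (∀ i y, ‖u i y‖ ≤ A y) → (∀ y, ‖u₀ y‖ ≤ A y) →
      (∀ y, Tendsto (fun i => u i y) l (𝓝 (u₀ y))) →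
      Tendsto (fun i => eLpNorm (u i - u₀) 2 volume) l (𝓝 0) := by
    intro u u₀ hu hu₀ hb hb₀ hl
    refine tendsto_eLpNorm_two_of_dominated (hA.const_mul 2)
      (Eventually.of_forall fun i => ((hu i).sub hu₀).1)
      (Eventually.of_forall fun i => Eventually.of_forall fun y => ?_) (Eventually.of_forall hl)
    linarith [norm_sub_le (u i y) (u₀ y), hb i y, hb₀ y]
  have hat := conv ha2 ha₀ haA haA₀ hal
  have hbt := conv hb2 hb₀ hbA hbA₀ hbl
  simp_rw [integral_mul_fejerMean (ha _) (hb _) (hT _)]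
  have e : (2 * Real.pi * ∫ y, a₀ y * b₀ y : ℂ) = ∫ w, (fejer w : ℂ) * ∫ y, a₀ y * b₀ y := by
    rw [integral_mul_const, integral_complex_ofReal, integral_fejer]; push_cast; rfl
  rw [e]
  have hA2 : Integrable fun y => A y ^ 2 := (memLp_two_iff_integrable_sq hA.1).1 hA
  have hsq : ∀ {u : ℝ → ℂ}, (∀ y, ‖u y‖ ≤ A y) → ∫ y, ‖u y‖ ^ 2 ≤ ∫ y, A y ^ 2 := fun hu =>
    integral_mono_of_nonneg (Eventually.of_forall fun y => by positivity) hA2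
      (Eventually.of_forall fun y => pow_le_pow_left₀ (norm_nonneg _) (hu y) 2)
  refine tendsto_integral_filter_of_dominated_convergence
    (fun w => fejer w * ((∫ y, A y ^ 2) + ∫ y, A y ^ 2)) ?_ ?_ (integrable_fejer.mul_const _) ?_
  · exact Eventually.of_forall fun i =>
      (integrable_fejer_mul_correlation (ha i) (hb i) (hT i)).1
  · refine Eventually.of_forall fun i => Eventually.of_forall fun w => ?_
    rw [norm_mul, Complex.norm_real, Real.norm_of_nonneg (fejer_nonneg w)]
    refine mul_le_mul_of_nonneg_left ?_ (fejer_nonneg w)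
    refine (norm_integral_mul_le (ha2 i) (memLp_translate (hb2 i) (w / T i))).trans ?_
    refine add_le_add (hsq (haA i)) ?_
    -- Translation invariance makes the bound on the correlation independent of the lag, so the
    -- Fejér kernel itself gives the majorant.
    rw [integral_sub_right_eq_self (fun y => ‖b i y‖ ^ 2)]
    exact hsq (hbA i)
  · exact Eventually.of_forall fun w => Tendsto.const_mul _
      (tendsto_integral_mul_translate (tendsto_div_of_tendsto_atTop hTl w) ha2 hb2 ha₀ hb₀ hat hbt)

end Limits

/-! ### Joint structure of the input and the output -/

section System

variable {P : Measure Ω} {X U : ℝ → Ω → ℝ} {f g H : ℝ → ℝ} {M : ℝ}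

/-- The output `Y(t)` as a curve in `L²(P)`. -/
def outputCurve (hX : IsStationaryGaussian P X f) (hU : IsStationaryGaussian P U g)
    (H : ℝ → ℝ) (t : ℝ) : Lp ℝ 2 P := fullFiltered hX.curve H t + hU.curve t

variable (hX : IsStationaryGaussian P X f) (hU : IsStationaryGaussian P U g)

/-- The closed linear span of the input and the noise. -/
def gaussianSpan : Submodule ℝ (Lp ℝ 2 P) :=
  (Submodule.span ℝ (Set.range (Sum.elim hX.curve hU.curve))).topologicalClosure

theorem isGaussianSpace_gaussianSpan (hXU : IsGaussianProcess (Sum.elim X U) P) :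
    IsGaussianSpace (gaussianSpan hX hU) := by
  intro ξ hξ
  refine map_eq_gaussianReal_of_mem_closure_span hXU ?_ ?_ hξ
  · rintro (t | t)
    · exact hX.centered t
    · exact hU.centered t
  · rintro (t | t)
    · exact hX.curve_ae_eq t
    · exact hU.curve_ae_eq t

theorem curve_mem_gaussianSpan (t : ℝ) : hX.curve t ∈ gaussianSpan hX hU :=
  Submodule.le_topologicalClosure _ (Submodule.subset_span ⟨Sum.inl t, rfl⟩)

theorem noise_mem_gaussianSpan (t : ℝ) : hU.curve t ∈ gaussianSpan hX hU :=
  Submodule.le_topologicalClosure _ (Submodule.subset_span ⟨Sum.inr t, rfl⟩)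

theorem outputCurve_mem_gaussianSpan (hM : ∀ y, f y ≤ M) (hH : MemLp H 2 volume) (t : ℝ) :
    outputCurve hX hU H t ∈ gaussianSpan hX hU :=
  Submodule.add_mem _
    (hX.hasSpectralDensity.fullFiltered_mem hM hH (Submodule.isClosed_topologicalClosure _)
      (curve_mem_gaussianSpan hX hU) t)
    (noise_mem_gaussianSpan hX hU t)

theorem inner_curve_noise (horth : ∀ s t, ∫ ω, X s ω * U t ω ∂P = 0) (s t : ℝ) :
    inner ℝ (hX.curve s) (hU.curve t) = 0 := by
  rw [IsStationaryGaussian.curve, IsStationaryGaussian.curve, real_inner_toLp, horth]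

theorem hasSpectralDensity_outputCurve (hM : ∀ y, f y ≤ M) (hH : MemLp H 2 volume)
    (horth : ∀ s t, ∫ ω, X s ω * U t ω ∂P = 0) :
    HasSpectralDensity (outputCurve hX hU H) fun y => ‖plancherel H hH y‖ ^ 2 * f y + g y := by
  have hV := hX.hasSpectralDensity.hasSpectralDensity_fullFiltered hM hH
  have hg := hU.hasSpectralDensity
  have hVU : ∀ t s, inner ℝ (fullFiltered hX.curve H t) (hU.curve s) = 0 := fun t s =>
    hX.hasSpectralDensity.inner_fullFiltered_eq_zero hM hH
      (fun r => inner_curve_noise hX hU horth r s) t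
  refine ⟨fun y => add_nonneg (hV.nonneg y) (hg.nonneg y), hV.integrable.add hg.integrable,
    fun s t => ?_⟩
  have e : inner ℝ (outputCurve hX hU H s) (outputCurve hX hU H t)
      = inner ℝ (fullFiltered hX.curve H s) (fullFiltered hX.curve H t)
        + inner ℝ (hU.curve s) (hU.curve t) := by
    rw [outputCurve, outputCurve, inner_add_left, inner_add_right, inner_add_right, hVU,
      real_inner_comm (fullFiltered hX.curve H t) (hU.curve s), hVU]
    ring
  rw [e, Complex.ofReal_add, hV.inner_eq, hg.inner_eq,
    ← integral_add (integrable_chr_mul hV.integrable_ofReal _)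
      (integrable_chr_mul hg.integrable_ofReal _)]
  congr 1; ext y; push_cast; ring

theorem inner_outputCurve_curve (hM : ∀ y, f y ≤ M) (hH : MemLp H 2 volume)
    (horth : ∀ s t, ∫ ω, X s ω * U t ω ∂P = 0) (t s : ℝ) :
    ((inner ℝ (outputCurve hX hU H t) (hX.curve s) : ℝ) : ℂ)
      = ∫ y, chr (t - s) y * (plancherel H hH y * f y) := by
  rw [outputCurve, inner_add_left, real_inner_comm (hX.curve s) (hU.curve t),
    inner_curve_noise hX hU horth, add_zero]
  exact hX.hasSpectralDensity.inner_fullFiltered_curve hM hH t s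

variable (hM : ∀ y, f y ≤ M) (hH : MemLp H 2 volume)
  (hXU : IsGaussianProcess (Sum.elim X U) P)

/-- The product `Y(t + τ) X(t)` as a curve in `L²(P)`. -/
def productCurve (τ t : ℝ) : Lp ℝ 2 P :=
  ((isGaussianSpace_gaussianSpan hX hU hXU).memLp_mul
    (outputCurve_mem_gaussianSpan hX hU hM hH (t + τ)) (curve_mem_gaussianSpan hX hU t)).toLp _

theorem productCurve_ae_eq (τ t : ℝ) : productCurve hX hU hM hH hXU τ t
    =ᵐ[P] fun ω => outputCurve hX hU H (t + τ) ω * hX.curve t ω :=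
  MemLp.coeFn_toLp _

theorem response_mul_ae_eq [IsProbabilityMeasure P] (τ t : ℝ) :
    (fun ω => response P H X U (t + τ) ω * X t ω) =ᵐ[P] productCurve hX hU hM hH hXU τ t := by
  filter_upwards [productCurve_ae_eq hX hU hM hH hXU τ t, hX.response_ae_eq hM hH hU (t + τ),
    hX.curve_ae_eq t] with ω h1 h2 h3
  rw [h1, h2, h3, outputCurve]

theorem integral_productCurve (τ t : ℝ) : ∫ ω, productCurve hX hU hM hH hXU τ t ω ∂P
    = inner ℝ (outputCurve hX hU H (t + τ)) (hX.curve t) := by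
  rw [integral_congr_ae (productCurve_ae_eq hX hU hM hH hXU τ t), real_inner_eq_integral]

/-- The three Wick pairings of `Y, X, Y, X`. The first is the product of the two means and
disappears after centring. -/
theorem inner_productCurve (τ₁ τ₂ t s : ℝ) :
    inner ℝ (productCurve hX hU hM hH hXU τ₁ t) (productCurve hX hU hM hH hXU τ₂ s)
      = inner ℝ (outputCurve hX hU H (t + τ₁)) (hX.curve t)
          * inner ℝ (outputCurve hX hU H (s + τ₂)) (hX.curve s)
        + inner ℝ (outputCurve hX hU H (t + τ₁)) (outputCurve hX hU H (s + τ₂))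
          * inner ℝ (hX.curve t) (hX.curve s)
        + inner ℝ (outputCurve hX hU H (t + τ₁)) (hX.curve s)
          * inner ℝ (hX.curve t) (outputCurve hX hU H (s + τ₂)) := by
  rw [← (isGaussianSpace_gaussianSpan hX hU hXU).integral_mul_mul_mul
    (outputCurve_mem_gaussianSpan hX hU hM hH _) (curve_mem_gaussianSpan hX hU _)
    (outputCurve_mem_gaussianSpan hX hU hM hH _) (curve_mem_gaussianSpan hX hU _),
    productCurve, productCurve, real_inner_toLp]
  simp_rw [mul_assoc]

theorem continuous_productCurve (horth : ∀ s t, ∫ ω, X s ω * U t ω ∂P = 0) (τ : ℝ) :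
    Continuous (productCurve hX hU hM hH hXU τ) := by
  refine continuous_of_continuous_inner ?_
  simp_rw [inner_productCurve]
  have h1 := hX.hasSpectralDensity.continuous
  have h2 := (hasSpectralDensity_outputCurve hX hU hM hH horth).continuous
  fun_prop

end System

/-! ### Covariance of the deviations -/

/-- Expectation as a continuous functional on `L²(P)`, so that it commutes with integrals in time.
-/
theorem integral_eq_inner_one {P : Measure Ω} [IsProbabilityMeasure P] (ξ : Lp ℝ 2 P) :
    ∫ ω, ξ ω ∂P
      = inner ℝ (indicatorConstLp 2 MeasurableSet.univ (measure_ne_top P univ) (1 : ℝ)) ξ := by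
  rw [L2.inner_indicatorConstLp_one, setIntegral_univ]

theorem inner_intervalIntegral {E : Type*} [NormedAddCommGroup E] [InnerProductSpace ℝ E]
    [CompleteSpace E] {ζ : ℝ → E} (hζ : Continuous ζ) (z : E) (a b : ℝ) :
    inner ℝ z (∫ t in a..b, ζ t) = ∫ t in a..b, inner ℝ z (ζ t) :=
  ((innerSL ℝ z).intervalIntegral_comp_comm (hζ.intervalIntegrable a b)).symm

theorem integral_deviation_mul_deviation {P : Measure Ω} [IsProbabilityMeasure P]
    {X U : ℝ → Ω → ℝ} {H : ℝ → ℝ} {c T τ₁ τ₂ : ℝ} (hT : 0 < T) {ζ₁ ζ₂ : ℝ → Lp ℝ 2 P}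
    (h₁ : Continuous ζ₁) (h₂ : Continuous ζ₂)
    (e₁ : ∀ t, (fun ω => response P H X U (t + τ₁) ω * X t ω) =ᵐ[P] ζ₁ t)
    (e₂ : ∀ t, (fun ω => response P H X U (t + τ₂) ω * X t ω) =ᵐ[P] ζ₂ t) :
    ∫ ω, deviation P H X U c T τ₁ ω * deviation P H X U c T τ₂ ω ∂P
      = 1 / (c ^ 2 * T) * ∫ t in 0..T, ∫ s in 0..T,
        (inner ℝ (ζ₁ t) (ζ₂ s) - (∫ ω, ζ₁ t ω ∂P) * ∫ ω, ζ₂ s ω ∂P) := by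
  set k := 1 / (c * T) with hk
  set I₁ : Lp ℝ 2 P := ∫ t in 0..T, ζ₁ t with hI₁
  set I₂ : Lp ℝ 2 P := ∫ t in 0..T, ζ₂ t with hI₂
  have d : ∀ (τ : ℝ) (I : Lp ℝ 2 P),
      msRiemannIntegral P (fun t ω => response P H X U (t + τ) ω * X t ω) 0 T =ᵐ[P] I →
      deviation P H X U c T τ =ᵐ[P] fun ω => √T * k * (I ω - ∫ ω', I ω' ∂P) := by
    intro τ I h
    have hE : ∫ ω', estimator P H X U c T τ ω' ∂P = k * ∫ ω', I ω' ∂P := by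
      rw [← integral_const_mul]
      refine integral_congr_ae ?_
      filter_upwards [h] with ω hω
      rw [estimator, hω]
    filter_upwards [h] with ω hω
    rw [deviation, hE, estimator, hω]
    ring
  have d₁ := d τ₁ I₁ (msRiemannIntegral_ae_eq e₁ h₁ hT.le)
  have d₂ := d τ₂ I₂ (msRiemannIntegral_ae_eq e₂ h₂ hT.le)
  have i₁ : Integrable I₁ P := (Lp.memLp I₁).integrable (by norm_num)
  have i₂ : Integrable I₂ P := (Lp.memLp I₂).integrable (by norm_num)
  have i₁₂ : Integrable (fun ω => I₁ ω * I₂ ω) P := (Lp.memLp I₁).integrable_mul (Lp.memLp I₂)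
  have key : ∫ ω, deviation P H X U c T τ₁ ω * deviation P H X U c T τ₂ ω ∂P
      = T * k ^ 2 * (inner ℝ I₁ I₂ - (∫ ω, I₁ ω ∂P) * ∫ ω, I₂ ω ∂P) := by
    set m₁ := ∫ ω, I₁ ω ∂P
    set m₂ := ∫ ω, I₂ ω ∂P
    have e : ∀ᵐ ω ∂P, deviation P H X U c T τ₁ ω * deviation P H X U c T τ₂ ω
        = T * k ^ 2 * (I₁ ω * I₂ ω - m₂ * I₁ ω - m₁ * I₂ ω + m₁ * m₂) := by
      filter_upwards [d₁, d₂] with ω h1 h2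
      rw [h1, h2]
      have := Real.mul_self_sqrt hT.le
      linear_combination k ^ 2 * (I₁ ω - m₁) * (I₂ ω - m₂) * this
    have i₃ : Integrable (fun ω => I₁ ω * I₂ ω - m₂ * I₁ ω) P := i₁₂.sub (i₁.const_mul m₂)
    have i₄ : Integrable (fun ω => I₁ ω * I₂ ω - m₂ * I₁ ω - m₁ * I₂ ω) P :=
      i₃.sub (i₂.const_mul m₁)
    rw [integral_congr_ae e, integral_const_mul, integral_add i₄ (integrable_const _),
      integral_sub i₃ (i₂.const_mul m₁), integral_sub i₁₂ (i₁.const_mul m₂),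
      integral_const_mul, integral_const_mul,
      ← real_inner_eq_integral]
    simp only [integral_const, probReal_univ, one_smul]
    ring
  have hm : ∀ {ζ : ℝ → Lp ℝ 2 P}, Continuous ζ → Continuous fun t => ∫ ω, ζ t ω ∂P := by
    intro ζ hζ
    simp_rw [integral_eq_inner_one]
    fun_prop
  have hmI : ∀ {ζ : ℝ → Lp ℝ 2 P}, Continuous ζ →
      ∫ ω, (∫ t in 0..T, ζ t : Lp ℝ 2 P) ω ∂P = ∫ t in 0..T, ∫ ω, ζ t ω ∂P := by
    intro ζ hζ
    simp_rw [integral_eq_inner_one]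
    exact inner_intervalIntegral hζ _ _ _
  have hII : inner ℝ I₁ I₂ = ∫ t in 0..T, ∫ s in 0..T, inner ℝ (ζ₁ t) (ζ₂ s) := by
    rw [real_inner_comm, hI₁, inner_intervalIntegral h₁]
    refine intervalIntegral.integral_congr fun t _ => ?_
    rw [real_inner_comm, hI₂, inner_intervalIntegral h₂]
  have hc : Continuous fun t => ∫ s in 0..T, inner ℝ (ζ₁ t) (ζ₂ s) :=
    intervalIntegral.continuous_parametric_intervalIntegral_of_continuous' (by fun_prop) _ _
  rw [key, hII, hmI h₁, hmI h₂]
  have hsub : ∀ t, ∫ s in 0..T, (inner ℝ (ζ₁ t) (ζ₂ s) - (∫ ω, ζ₁ t ω ∂P) * ∫ ω, ζ₂ s ω ∂P)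
      = (∫ s in 0..T, inner ℝ (ζ₁ t) (ζ₂ s))
        - (∫ ω, ζ₁ t ω ∂P) * ∫ s in 0..T, ∫ ω, ζ₂ s ω ∂P := by
    intro t
    have hm2 := hm h₂
    rw [intervalIntegral.integral_sub
      ((by fun_prop : Continuous fun s => inner ℝ (ζ₁ t) (ζ₂ s)).intervalIntegrable _ _)
      ((by fun_prop : Continuous fun s =>
        (∫ ω, ζ₁ t ω ∂P) * ∫ ω, ζ₂ s ω ∂P).intervalIntegrable _ _),
      intervalIntegral.integral_const_mul]
  simp_rw [hsub]
  have hc' : Continuous fun t => (∫ ω, ζ₁ t ω ∂P) * ∫ s in 0..T, ∫ ω, ζ₂ s ω ∂P :=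
    (hm h₁).mul continuous_const
  rw [intervalIntegral.integral_sub (hc.intervalIntegrable _ _) (hc'.intervalIntegrable _ _),
    intervalIntegral.integral_mul_const]
  have hk2 : T * k ^ 2 = 1 / (c ^ 2 * T) := by
    rw [hk]
    -- For `c = 0` both sides vanish because division by zero gives zero.
    rcases eq_or_ne c 0 with rfl | hc0
    · simp
    · field_simp
  rw [hk2]

section Covariance

variable {P : Measure Ω} [IsProbabilityMeasure P] {X U : ℝ → Ω → ℝ} {f g H : ℝ → ℝ} {M : ℝ}

/-- The covariance of the deviations in terms of the spectral densities. -/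
theorem covariance_deviation_eq (hX : IsStationaryGaussian P X f)
    (hU : IsStationaryGaussian P U g) (hM : ∀ y, f y ≤ M) (hH : MemLp H 2 volume)
    (horth : ∀ s t, ∫ ω, X s ω * U t ω ∂P = 0) (hXU : IsGaussianProcess (Sum.elim X U) P)
    (c τ₁ τ₂ : ℝ) {T : ℝ} (hT : 0 < T) :
    ((∫ ω, deviation P H X U c T τ₁ ω * deviation P H X U c T τ₂ ω ∂P : ℝ) : ℂ)
      = 1 / (c : ℂ) ^ 2 * ((∫ y, chr (τ₁ - τ₂) y * ((‖plancherel H hH y‖ ^ 2 * f y + g y : ℝ) : ℂ)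
          * fejerMean (fun y => (f y : ℂ)) T y)
        + ∫ y, chr τ₁ y * (plancherel H hH y * f y)
          * fejerMean (fun y => chr τ₂ y * (plancherel H hH y * f y)) T y) := by
  have hx := hX.hasSpectralDensity
  have hy := hasSpectralDensity_outputCurve hX hU hM hH horth
  have cx := hx.continuous
  have cy := hy.continuous
  set x := hX.curve
  set Y := outputCurve hX hU H
  set S : ℝ → ℝ := fun y => ‖plancherel H hH y‖ ^ 2 * f y + g y with hS
  have hHf : Integrable fun y => plancherel H hH y * (f y : ℂ) :=
    integrable_mul_of_memLp_two (memLp_plancherel H hH)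
      (memLp_two_of_bounded hx.integrable hx.nonneg hM).ofReal
  rw [integral_deviation_mul_deviation hT (continuous_productCurve hX hU hM hH hXU horth τ₁)
    (continuous_productCurve hX hU hM hH hXU horth τ₂)
    (response_mul_ae_eq hX hU hM hH hXU τ₁) (response_mul_ae_eq hX hU hM hH hXU τ₂)]
  have hsimp : ∀ t s, inner ℝ (productCurve hX hU hM hH hXU τ₁ t)
      (productCurve hX hU hM hH hXU τ₂ s)
      - (∫ ω, productCurve hX hU hM hH hXU τ₁ t ω ∂P)
        * ∫ ω, productCurve hX hU hM hH hXU τ₂ s ω ∂P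
      = inner ℝ (Y (t + τ₁)) (Y (s + τ₂)) * inner ℝ (x t) (x s)
        + inner ℝ (Y (t + τ₁)) (x s) * inner ℝ (x t) (Y (s + τ₂)) := by
    intro t s
    rw [inner_productCurve, integral_productCurve, integral_productCurve]
    ring
  simp_rw [hsimp]
  have split : ∫ t in 0..T, ∫ s in 0..T,
      (inner ℝ (Y (t + τ₁)) (Y (s + τ₂)) * inner ℝ (x t) (x s)
        + inner ℝ (Y (t + τ₁)) (x s) * inner ℝ (x t) (Y (s + τ₂)))
      = (∫ t in 0..T, ∫ s in 0..T, inner ℝ (Y (t + τ₁)) (Y (s + τ₂)) * inner ℝ (x t) (x s))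
        + ∫ t in 0..T, ∫ s in 0..T,
          inner ℝ (Y (t + τ₁)) (x s) * inner ℝ (x t) (Y (s + τ₂)) := by
    rw [← intervalIntegral.integral_add]
    · refine intervalIntegral.integral_congr fun t _ => ?_
      exact intervalIntegral.integral_add
        ((by fun_prop : Continuous fun s =>
          inner ℝ (Y (t + τ₁)) (Y (s + τ₂)) * inner ℝ (x t) (x s)).intervalIntegrable _ _)
        ((by fun_prop : Continuous fun s =>
          inner ℝ (Y (t + τ₁)) (x s) * inner ℝ (x t) (Y (s + τ₂))).intervalIntegrable _ _)
    · exact (intervalIntegral.continuous_parametric_intervalIntegral_of_continuous'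
        (by fun_prop) _ _).intervalIntegrable _ _
    · exact (intervalIntegral.continuous_parametric_intervalIntegral_of_continuous'
        (by fun_prop) _ _).intervalIntegrable _ _
  -- Symmetry of the real inner product allows the lag `-(t - s)`. Against the lag `t - s` in the
  -- other factor, this produces the frequency difference on which the Fejér kernel depends.
  have hf' : ∀ t s, ((inner ℝ (x t) (x s) : ℝ) : ℂ) = ∫ y, chr (-(t - s)) y * (f y : ℂ) := by
    intro t s
    rw [real_inner_comm, hx.inner_eq, neg_sub]
  have hY' : ∀ t s, ((inner ℝ (Y (t + τ₁)) (Y (s + τ₂)) : ℝ) : ℂ)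
      = ∫ y, chr (t - s) y * (chr (τ₁ - τ₂) y * (S y : ℂ)) := by
    intro t s
    rw [hy.inner_eq, show t + τ₁ - (s + τ₂) = t - s + (τ₁ - τ₂) by ring]
    simp_rw [chr_add, mul_assoc]
  have hYx : ∀ t s, ((inner ℝ (Y (t + τ₁)) (x s) : ℝ) : ℂ)
      = ∫ y, chr (t - s) y * (chr τ₁ y * (plancherel H hH y * f y)) := by
    intro t s
    rw [inner_outputCurve_curve hX hU hM hH horth, show t + τ₁ - s = t - s + τ₁ by ring]
    simp_rw [chr_add, mul_assoc]
  -- Here the lag is already `-(t - s) + τ₂`, so no conjugation occurs; this is why the limit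
  -- contains `(H*)²` with the character of `τ₁ + τ₂`.
  have hxY : ∀ t s, ((inner ℝ (x t) (Y (s + τ₂)) : ℝ) : ℂ)
      = ∫ y, chr (-(t - s)) y * (chr τ₂ y * (plancherel H hH y * f y)) := by
    intro t s
    rw [real_inner_comm, inner_outputCurve_curve hX hU hM hH horth,
      show s + τ₂ - t = -(t - s) + τ₂ by ring]
    simp_rw [chr_add, mul_assoc]
  have cast : ∀ F : ℝ → ℝ → ℝ, ((∫ t in 0..T, ∫ s in 0..T, F t s : ℝ) : ℂ)
      = ∫ t in 0..T, ∫ s in 0..T, (F t s : ℂ) := by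
    intro F
    rw [← intervalIntegral.integral_ofReal]
    simp_rw [← intervalIntegral.integral_ofReal]
  rw [split, Complex.ofReal_mul, Complex.ofReal_add, cast, cast]
  simp_rw [Complex.ofReal_mul, hf', hY', hYx, hxY]
  rw [integral_integral_chr_mul_chr (integrable_chr_mul hy.integrable_ofReal (τ₁ - τ₂))
      hx.integrable_ofReal hT,
    integral_integral_chr_mul_chr (integrable_chr_mul hHf τ₁) (integrable_chr_mul hHf τ₂) hT,
    ← mul_add, ← mul_assoc]
  congr 1
  push_cast
  have : (T : ℂ) ≠ 0 := by exact_mod_cast hT.ne'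
  rcases eq_or_ne c 0 with rfl | hc0
  · simp
  · have : (c : ℂ) ≠ 0 := by exact_mod_cast hc0
    field_simp

end Covariance

/-! ### The limit of the spectral expression -/

/-- Puts the target in the shape the limit arguments produce: `f` is replaced by `c / 2π` and the
Fejér kernel by its mass `2π`. -/
theorem limitCorr_eq {H : ℝ → ℝ} (hH : MemLp H 2 volume) {g : ℝ → ℝ} (hg : Integrable g)
    {c : ℝ} (hc : 0 < c) (τ₁ τ₂ : ℝ) :
    limitCorr H hH g c τ₁ τ₂ = 1 / (c : ℂ) ^ 2 *
      ((∫ y, chr (τ₁ - τ₂) y * ((‖plancherel H hH y‖ ^ 2 * (c / (2 * Real.pi)) + g y : ℝ) : ℂ)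
          * (2 * Real.pi * ((c / (2 * Real.pi) : ℝ) : ℂ)))
        + 2 * Real.pi * ∫ y, chr τ₁ y * (plancherel H hH y * ((c / (2 * Real.pi) : ℝ) : ℂ))
          * (chr τ₂ y * (plancherel H hH y * ((c / (2 * Real.pi) : ℝ) : ℂ)))) := by
  have hm := memLp_plancherel H hH
  have hS : Integrable fun y => ‖plancherel H hH y‖ ^ 2 * (c / (2 * Real.pi)) + g y :=
    ((hm.integrable_norm_pow (by norm_num)).mul_const _).add hg
  have hS' : Integrable fun y =>
      ((‖plancherel H hH y‖ ^ 2 * (c / (2 * Real.pi)) + g y : ℝ) : ℂ) := hS.ofReal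
  have i₁ := (integrable_chr_mul hS' (τ₁ - τ₂)).mul_const
    (2 * Real.pi * ((c / (2 * Real.pi) : ℝ) : ℂ))
  have hmc := hm.mul_const ((c / (2 * Real.pi) : ℝ) : ℂ)
  have i₂ := (integrable_mul_of_memLp_two (memLp_chr_mul hmc τ₁)
    (memLp_chr_mul hmc τ₂)).const_mul (2 * Real.pi : ℂ)
  rw [← integral_const_mul, ← integral_add i₁ i₂, ← integral_const_mul, limitCorr,
    ← integral_const_mul]
  refine integral_congr_ae (Eventually.of_forall fun y => ?_)
  have hc' : (c : ℂ) ≠ 0 := by exact_mod_cast hc.ne'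
  have hpi : (Real.pi : ℂ) ≠ 0 := by exact_mod_cast Real.pi_ne_zero
  have e₁ : Complex.exp (Complex.I * (τ₁ - τ₂) * y) = chr (τ₁ - τ₂) y := by
    rw [chr]; push_cast; rfl
  have e₂ : Complex.exp (Complex.I * (τ₁ + τ₂) * y) = chr τ₁ y * chr τ₂ y := by
    rw [← chr_add, chr]; push_cast; rfl
  simp only
  rw [e₁, e₂]
  push_cast
  field_simp

theorem tendsto_spectral_covariance {H : ℝ → ℝ} (hH : MemLp H 2 volume) {g : ℝ → ℝ}
    (hg : Integrable g) (hg0 : ∀ y, 0 ≤ g y) {c : ℝ} (hc : 0 < c) (τ₁ τ₂ : ℝ) {ι : Type*}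
    {l : Filter ι} [l.IsCountablyGenerated] {T : ι → ℝ} (hTl : Tendsto T l atTop)
    (hT : ∀ i, 0 < T i) {f : ι → ℝ → ℝ} {M : ℝ} (hM0 : c / (2 * Real.pi) ≤ M)
    (hf : ∀ i, Integrable (f i))
    (hf0 : ∀ i y, 0 ≤ f i y) (hfM : ∀ i y, f i y ≤ M)
    (hfl : ∀ R > 0, TendstoUniformlyOn f (fun _ => c / (2 * Real.pi)) l (Icc (-R) R)) :
    Tendsto (fun i => 1 / (c : ℂ) ^ 2 *
      ((∫ y, chr (τ₁ - τ₂) y * ((‖plancherel H hH y‖ ^ 2 * f i y + g y : ℝ) : ℂ)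
          * fejerMean (fun y => (f i y : ℂ)) (T i) y)
        + ∫ y, chr τ₁ y * (plancherel H hH y * f i y)
          * fejerMean (fun y => chr τ₂ y * (plancherel H hH y * f i y)) (T i) y))
      l (𝓝 (limitCorr H hH g c τ₁ τ₂)) := by
  have hm := memLp_plancherel H hH
  have hpt : ∀ y, Tendsto (fun i => f i y) l (𝓝 (c / (2 * Real.pi))) := fun y =>
    (hfl (|y| + 1) (by positivity)).tendsto_at
      ⟨by linarith [neg_abs_le y], by linarith [le_abs_self y]⟩
  have hptC : ∀ y, Tendsto (fun i => (f i y : ℂ)) l (𝓝 ((c / (2 * Real.pi) : ℝ) : ℂ)) := fun y =>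
    (Complex.continuous_ofReal.tendsto _).comp (hpt y)
  have hfC : ∀ i, Integrable fun y => (f i y : ℂ) := fun i => (hf i).ofReal
  have hnorm : ∀ i y, ‖(f i y : ℂ)‖ ≤ M := fun i y => by
    rw [Complex.norm_real, Real.norm_of_nonneg (hf0 i y)]; exact hfM i y
  have hf2 : ∀ i, MemLp (fun y => (f i y : ℂ)) 2 volume := fun i =>
    (memLp_two_of_bounded (hf i) (hf0 i) (hfM i)).ofReal
  have hbd : ∀ (τ : ℝ) (y : ℝ) {r : ℝ}, 0 ≤ r → r ≤ M →
      ‖chr τ y * (plancherel H hH y * (r : ℂ))‖ ≤ ‖plancherel H hH y‖ * M := by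
    intro τ y r h0 h1
    rw [norm_mul, norm_chr, one_mul, norm_mul, Complex.norm_real, Real.norm_of_nonneg h0]
    exact mul_le_mul_of_nonneg_left h1 (norm_nonneg _)
  have hc2 : 0 ≤ c / (2 * Real.pi) := by positivity
  rw [limitCorr_eq hH hg hc]
  refine Tendsto.const_mul _ (Tendsto.add ?_ ?_)
  · refine tendsto_integral_mul_fejerMean hTl hT
      (A := fun y => ‖plancherel H hH y‖ ^ 2 * M + g y) (M := M) ?_ ?_ ?_ ?_ hfC hnorm ?_
    · intro i
      refine (continuous_const.chr continuous_id).aestronglyMeasurable.mul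
        (Complex.continuous_ofReal.comp_aestronglyMeasurable ?_)
      exact ((hm.1.norm.pow 2).mul (hf i).1).add hg.1
    · intro i y
      have h0 : 0 ≤ ‖plancherel H hH y‖ ^ 2 * f i y + g y :=
        add_nonneg (mul_nonneg (by positivity) (hf0 i y)) (hg0 y)
      rw [norm_mul, norm_chr, one_mul, Complex.norm_real, Real.norm_of_nonneg h0]
      gcongr
      exact hfM i y
    · exact ((hm.integrable_norm_pow (by norm_num)).mul_const _).add hg
    · intro y
      refine Tendsto.const_mul _ ((Complex.continuous_ofReal.tendsto _).comp ?_)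
      exact ((hpt y).const_mul _).add_const _
    · intro R hR
      exact Complex.isometry_ofReal.uniformContinuous.comp_tendstoUniformlyOn (hfl R hR)
  · refine tendsto_integral_fejer_mul_correlation hTl hT
      (A := fun y => ‖plancherel H hH y‖ * M) (hm.norm.mul_const M)
      (fun i => integrable_chr_mul (integrable_mul_of_memLp_two hm (hf2 i)) τ₁)
      (fun i => integrable_chr_mul (integrable_mul_of_memLp_two hm (hf2 i)) τ₂)
      (memLp_chr_mul (hm.mul_const _) τ₁) (memLp_chr_mul (hm.mul_const _) τ₂)
      (fun i y => hbd τ₁ y (hf0 i y) (hfM i y)) (fun i y => hbd τ₂ y (hf0 i y) (hfM i y))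
      (fun y => hbd τ₁ y hc2 hM0) (fun y => hbd τ₂ y hc2 hM0)
      (fun y => ((hptC y).const_mul _).const_mul _) (fun y => ((hptC y).const_mul _).const_mul _)

end Correlogram

end

theorem mainTheorem9 {Ω : Type*} [MeasurableSpace Ω] (P : Measure Ω) [IsProbabilityMeasure P]
    (X : ℝ → ℝ → Ω → ℝ) (U : ℝ → Ω → ℝ) (f : ℝ → ℝ → ℝ) (g : ℝ → ℝ) (H : ℝ → ℝ) (c : ℝ)
    (hX : ∀ Δ > 0, Correlogram.IsStationaryGaussian P (X Δ) (f Δ))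
    (hf_bdd : ∃ M : ℝ, ∀ Δ > 0, ∀ x, f Δ x ≤ M)
    (hc : 0 < c)
    (hf_lim : ∀ a > 0,
      TendstoUniformlyOn f (fun _ => c / (2 * Real.pi)) atTop (Icc (-a) a))
    (hK : ∀ Δ > 0, Integrable (Correlogram.corrFun P (X Δ)))
    (hU : Correlogram.IsStationaryGaussian P U g)
    (hXU_joint : ∀ Δ > 0, IsGaussianProcess (Sum.elim (X Δ) U) P)
    (hXU_orth : ∀ Δ > 0, ∀ s t, ∫ ω, X Δ s ω * U t ω ∂P = 0)
    (hH : MemLp H 2 volume) :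
    (∀ Δ > 0, ∀ t, Correlogram.MsConverges P (atBot ×ˢ atTop)
      (Correlogram.truncatedResponse H (X Δ) t)) ∧
    (∀ T > 0, ∀ Δ > 0, ∀ τ, Correlogram.MsConverges P (Correlogram.meshFilter 0 T)
      (Correlogram.riemannSum fun t ω =>
        Correlogram.response P H (X Δ) U (t + τ) ω * X Δ t ω)) ∧
    ∀ τ₁ τ₂ : ℝ, Tendsto
      (fun p : ℝ × ℝ => ((∫ ω, Correlogram.deviation P H (X p.2) U c p.1 τ₁ ω *
        Correlogram.deviation P H (X p.2) U c p.1 τ₂ ω ∂P : ℝ) : ℂ))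
      (atTop ×ˢ atTop) (𝓝 (Correlogram.limitCorr H hH g c τ₁ τ₂)) := by
  obtain ⟨M, hM⟩ := hf_bdd
  refine ⟨fun Δ hΔ t => (hX Δ hΔ).msConverges_truncatedResponse (hM Δ hΔ) hH t,
    fun T hT Δ hΔ τ => ?_, fun τ₁ τ₂ => ?_⟩
  · exact Correlogram.msConverges_riemannSum
      (Correlogram.response_mul_ae_eq (hX Δ hΔ) hU (hM Δ hΔ) hH (hXU_joint Δ hΔ) τ)
      (Correlogram.continuous_productCurve (hX Δ hΔ) hU (hM Δ hΔ) hH (hXU_joint Δ hΔ)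
        (hXU_orth Δ hΔ) τ) (le_of_lt hT)
  · have hT : ∀ p : ℝ × ℝ, 0 < max p.1 1 := fun p => lt_max_of_lt_right one_pos
    have hΔ : ∀ p : ℝ × ℝ, 0 < max p.2 1 := fun p => lt_max_of_lt_right one_pos
    -- The limiting density must obey the same bound, since the majorant in the cross term has to
    -- dominate the limit functions too.
    have hle : c / (2 * Real.pi) ≤ M := by
      have h0 := (hf_lim 1 one_pos).tendsto_at (x := 0) (by simp)
      refine le_of_tendsto h0 ?_
      filter_upwards [eventually_gt_atTop 0] with Δ hΔ using hM Δ hΔ 0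
    have hmax : Tendsto (fun p : ℝ × ℝ => max p.2 1) (atTop ×ˢ atTop) atTop :=
      tendsto_atTop_mono (fun p => le_max_left _ _) tendsto_snd
    have key := Correlogram.tendsto_spectral_covariance hH hU.density_integrable
      hU.density_nonneg hc τ₁ τ₂ (l := atTop ×ˢ atTop) (T := fun p : ℝ × ℝ => max p.1 1)
      (tendsto_atTop_mono (fun p => le_max_left _ _) tendsto_fst) hT
      (f := fun p => f (max p.2 1)) hle (fun p => (hX _ (hΔ p)).density_integrable)
      (fun p => (hX _ (hΔ p)).density_nonneg) (fun p => hM _ (hΔ p))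
      (fun R hR u hu => hmax.eventually (hf_lim R hR u hu))
    refine key.congr' ?_
    filter_upwards [tendsto_fst.eventually (eventually_ge_atTop 1),
      tendsto_snd.eventually (eventually_ge_atTop 1)] with p h1 h2
    have hp1 : (0 : ℝ) < p.1 := lt_of_lt_of_le one_pos h1
    have hp2 : (0 : ℝ) < p.2 := lt_of_lt_of_le one_pos h2
    rw [max_eq_left h1, max_eq_left h2]
    exact (Correlogram.covariance_deviation_eq (hX _ hp2) hU (hM _ hp2) hH (hXU_orth _ hp2)
      (hXU_joint _ hp2) c τ₁ τ₂ hp1).symm
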